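/- Let $I,J$ be disjoint index sets, $n\ge 1$ and $\alpha\colon\{1,\dots,n\}\to I\sqcup J$. Call $k$ a left node if $\alpha(k)\in I$ and a right node if $\alpha(k)\in J$. Let $s_\alpha\in S_n$ be the permutation listing first the left nodes in increasing order and then the right nodes in decreasing order, and let $BNC(\alpha)$ be the set of partitions $\pi$ of $\{1,\dots,n\}$ such that $s_\alpha^{-1}\cdot\pi$ is non-crossing, ordered by refinement, with Möbius function $\mu_{BNC}$. A shading is an element $\epsilon\in\{',''\}^n$; for a partition $\pi$ write $\pi\le\epsilon$ if $\epsilon$ is constant on every block $V$ of $\pi$, and then let $\epsilon(V)$ be its value on $V$. For each shading $\epsilon$ define the polynomial, in commuting indeterminates $X'_K,X''_K$ indexed by the non-empty subsets $K\subseteq\{1,\dots,n\}$, $$P_{\alpha,\epsilon}:=\sum_{\substack{\pi\in BNC(\alpha)\\ \pi\le\epsilon}}\Bigg[\sum_{\substack{\sigma\in BNC(\alpha)\\ \pi\le\sigma\le\epsilon}}\mu_{BNC}(\pi,\sigma)\Bigg]\prod_{V\in\pi}X_V^{\epsilon(V)},$$ and let $Q_\alpha:=\sum_{\epsilon}P_{\alpha,\epsilon}$,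 the sum over all shadings. Then $$Q_\alpha=X'_{\{1,\dots,n\}}+X''_{\{1,\dots,n\}}+\sum_{\epsilon\text{ non-constant}}P_{\alpha,\epsilon}.$$ Moreover these polynomials are universal: for every unital complex algebra $\mathcal A$ with a linear functional $\varphi$, $\varphi(1)=1$, and every bi-free pair (in the sense of Voiculescu) of two-faced families $z'=((z'_i)_{i\in I},(z'_j)_{j\in J})$ and $z''=((z''_i)_{i\in I},(z''_j)_{j\in J})$ in $\mathcal A$, one has $$\varphi\big(z^{\epsilon_1}_{\alpha(1)}\cdots z^{\epsilon_n}_{\alpha(n)}\big)=P_{\alpha,\epsilon}(z',z'')\ \text{ for every shading }\epsilon,$$ $$\varphi\big((z'+z'')_{\alpha(1)}\cdots(z'+z'')_{\alpha(n)}\big)=Q_\alpha(z',z''),$$ where $(z',z'')$ means evaluation at $X^{\delta}_{\{k_1<\dots<k_r\}}=\varphi\big(z^{\delta}_{\alpha(k_1)}\cdots z^{\delta}_{\alpha(k_r)}\big)$, $\delta\in\{',''\}$. -/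

import Mathlib

universe u v w x

/-! ### Shadings and two-faced families

A shade is one of the two marks `'` and `''`.  A two-faced family in an algebra `A`, with left face
indexed by `I` and right face indexed by `J`, is a function `I ⊕ J → A` (`Sum.inl` is the left face,
`Sum.inr` the right face), and a pair `(z', z'')` of such families is `z : Shade → I ⊕ J → A`. -/

/-- The two shades `'` and `''`. -/
inductive Shade
  | prime
  | dprime
  deriving DecidableEq

instance : Fintype Shade := ⟨{.prime, .dprime}, fun δ => by cases δ <;> simp⟩

/-- The opposite shade. -/
def Shade.other : Shade → Shade
  | .prime => .dprime
  | .dprime => .prime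

/-! ### Vector spaces with a specified state-vector and their free product -/

/-- A complex vector space `X` with a specified state-vector `ξ` and a splitting `X = ℂ ξ ⊕ X°`.
The splitting is recorded by the linear functional `state` with `state ξ = 1`: the complement is
`X° = ker state`, and the projection onto `ℂ ξ` along `X°` is `p x = state x • ξ`. -/
structure StateVectorSpace where
  carrier : Type*
  [grp : AddCommGroup carrier]
  [mod : Module ℂ carrier]
  vec : carrier
  state : carrier →ₗ[ℂ] ℂ
  state_vec : state vec = 1

namespace StateVectorSpace

instance : CoeSort StateVectorSpace (Type _) := ⟨StateVectorSpace.carrier⟩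

attribute [instance] StateVectorSpace.grp StateVectorSpace.mod

/-- The complement `X°`. -/
abbrev kernel (X : StateVectorSpace) : Submodule ℂ X := LinearMap.ker X.state

/-- The state `T ↦ state (T ξ)` on the algebra `𝓛(X)` of linear operators on `X`. -/
def vacuumState (X : StateVectorSpace) : Module.End ℂ X →ₗ[ℂ] ℂ :=
  X.state ∘ₗ LinearMap.applyₗ X.vec

/-- `1 - p`, as a map from `X` to `X°`. -/
def center (X : StateVectorSpace) : X →ₗ[ℂ] X.kernel :=
  LinearMap.codRestrict X.kernel (LinearMap.id - X.state.smulRight X.vec) (fun x => by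
    simp [X.state_vec])

end StateVectorSpace

namespace FreeProd

variable (X : Shade → StateVectorSpace)

/-- The direct sum `X'° ⊕ X''°`. -/
abbrev Letters := (δ : Shade) → (X δ).kernel

/-- The tensor algebra of `X'° ⊕ X''°`, i.e. the direct sum of all tensor products
`X^{ε₁}° ⊗ ⋯ ⊗ X^{εₙ}°`.  The free product is the part of it where neighbouring shades differ. -/
abbrev Full := TensorAlgebra ℂ (Letters X)

variable {X}

/-- An element of `X^δ°` as a tensor word of length one. -/
noncomputable def letter (δ : Shade) : (X δ).kernel →ₗ[ℂ] Full X :=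
  TensorAlgebra.ι ℂ ∘ₗ LinearMap.single ℂ (fun δ => (X δ).kernel) δ

/-- The embedding `X^δ = ℂ ξ^δ ⊕ X^δ° → ℂ 1 ⊕ (words of length one)`. -/
noncomputable def embed (δ : Shade) : X δ →ₗ[ℂ] Full X :=
  (X δ).state.smulRight (1 : Full X) + letter δ ∘ₗ (X δ).center

/-- The tensor word `x₁ ⊗ ⋯ ⊗ xₙ`; the empty word is `1`. -/
noncomputable def word (l : List ((δ : Shade) × (X δ).kernel)) : Full X :=
  (l.map fun a => letter a.1 a.2).prod

/-- Neighbouring letters have different shades. -/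
def IsAlternating (l : List ((δ : Shade) × (X δ).kernel)) : Prop :=
  l.IsChain fun a b => a.1 ≠ b.1

variable (X) in
/-- `ℂ 1 ⊕ ⨁_{n ≥ 1} ⨁_{ε₁ ≠ ε₂ ≠ ⋯ ≠ εₙ} X^{ε₁}° ⊗ ⋯ ⊗ X^{εₙ}°`. -/
noncomputable def alternating : Submodule ℂ (Full X) :=
  Submodule.span ℂ {w | ∃ l, IsAlternating l ∧ w = word l}

theorem word_mem {l : List ((δ : Shade) × (X δ).kernel)} (h : IsAlternating l) :
    word l ∈ alternating X :=
  Submodule.subset_span ⟨l, h, rfl⟩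

variable (X) in
/-- The free product `(X', p', ξ') * (X'', p'', ξ'')`: its state-vector is the empty word, and its
state is the projection to the words of length zero. -/
noncomputable def freeProduct : StateVectorSpace where
  carrier := alternating X
  vec := ⟨1, word_mem (l := []) List.IsChain.nil⟩
  state := TensorAlgebra.algebraMapInv.toLinearMap ∘ₗ (alternating X).subtype
  state_vec := by simp

section Peel

variable {V : Type*} [AddCommGroup V] [Module ℂ V]

/-- Auxiliary algebra homomorphism for `peelLeft`. -/
noncomputable def peelLeftAux (g : V →ₗ[ℂ] TensorAlgebra ℂ V) :
    TensorAlgebra ℂ V →ₐ[ℂ] Module.End ℂ (TensorAlgebra ℂ V × TensorAlgebra ℂ V) :=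
  TensorAlgebra.lift ℂ
    { toFun := fun v => LinearMap.prod
        (LinearMap.mulLeft ℂ (TensorAlgebra.ι ℂ v) ∘ₗ LinearMap.fst ℂ _ _)
        (LinearMap.mulLeft ℂ (g v) ∘ₗ LinearMap.fst ℂ _ _)
      map_add' := fun v w => by ext <;> simp [add_mul]
      map_smul' := fun c v => by ext <;> simp }

/-- The linear map with `1 ↦ c` and `v ⊗ w ↦ g(v) ⊗ w` for every vector `v` and tensor `w`
(see `peelLeft_one` and `peelLeft_ι_mul`). -/
noncomputable def peelLeft (c : TensorAlgebra ℂ V) (g : V →ₗ[ℂ] TensorAlgebra ℂ V) :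
    TensorAlgebra ℂ V →ₗ[ℂ] TensorAlgebra ℂ V :=
  LinearMap.snd ℂ _ _ ∘ₗ LinearMap.applyₗ (1, c) ∘ₗ (peelLeftAux g).toLinearMap

/-- Auxiliary algebra homomorphism for `peelRight`. -/
noncomputable def peelRightAux (g : V →ₗ[ℂ] TensorAlgebra ℂ V) :
    TensorAlgebra ℂ V →ₐ[ℂ] (Module.End ℂ (TensorAlgebra ℂ V × TensorAlgebra ℂ V))ᵐᵒᵖ :=
  TensorAlgebra.lift ℂ
    { toFun := fun v => MulOpposite.op (LinearMap.prod
        (LinearMap.mulRight ℂ (TensorAlgebra.ι ℂ v) ∘ₗ LinearMap.fst ℂ _ _)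
        (LinearMap.mulRight ℂ (g v) ∘ₗ LinearMap.fst ℂ _ _))
      map_add' := fun v w => by
        apply MulOpposite.unop_injective; ext <;> simp [mul_add]
      map_smul' := fun c v => by
        apply MulOpposite.unop_injective; ext <;> simp }

/-- The linear map with `1 ↦ c` and `w ⊗ v ↦ w ⊗ g(v)` for every vector `v` and tensor `w`
(see `peelRight_one` and `peelRight_mul_ι`). -/
noncomputable def peelRight (c : TensorAlgebra ℂ V) (g : V →ₗ[ℂ] TensorAlgebra ℂ V) :
    TensorAlgebra ℂ V →ₗ[ℂ] TensorAlgebra ℂ V :=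
  LinearMap.snd ℂ _ _ ∘ₗ LinearMap.applyₗ (1, c) ∘ₗ
    (MulOpposite.opLinearEquiv ℂ).symm.toLinearMap ∘ₗ (peelRightAux g).toLinearMap

theorem peelLeftAux_fst (g : V →ₗ[ℂ] TensorAlgebra ℂ V) (w : TensorAlgebra ℂ V) :
    ∀ p, (peelLeftAux g w p).1 = w * p.1 := by
  induction w using TensorAlgebra.induction with
  | algebraMap r => intro p; simp [Algebra.smul_def]
  | ι v => intro p; simp [peelLeftAux]
  | mul a b ha hb => intro p; simp [ha, hb, mul_assoc]
  | add a b ha hb => intro p; simp [ha, hb, add_mul]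

theorem peelRightAux_fst (g : V →ₗ[ℂ] TensorAlgebra ℂ V) (w : TensorAlgebra ℂ V) :
    ∀ p, ((peelRightAux g w).unop p).1 = p.1 * w := by
  induction w using TensorAlgebra.induction with
  | algebraMap r => intro p; simp [Algebra.smul_def, Algebra.commutes]
  | ι v => intro p; simp [peelRightAux]
  | mul a b ha hb => intro p; simp [ha, hb, mul_assoc]
  | add a b ha hb => intro p; simp [ha, hb, mul_add]

theorem peelLeft_one (c : TensorAlgebra ℂ V) (g : V →ₗ[ℂ] TensorAlgebra ℂ V) :
    peelLeft c g 1 = c := by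
  simp [peelLeft]

theorem peelLeft_ι_mul (c : TensorAlgebra ℂ V) (g : V →ₗ[ℂ] TensorAlgebra ℂ V) (v : V)
    (w : TensorAlgebra ℂ V) : peelLeft c g (TensorAlgebra.ι ℂ v * w) = g v * w := by
  have h := peelLeftAux_fst g w (1, c)
  simp only [mul_one] at h
  have h2 : ∀ p, (peelLeftAux g (TensorAlgebra.ι ℂ v) p).2 = g v * p.1 := by
    intro p; simp [peelLeftAux]
  simp [peelLeft, h2, h]

theorem peelRight_one (c : TensorAlgebra ℂ V) (g : V →ₗ[ℂ] TensorAlgebra ℂ V) :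
    peelRight c g 1 = c := by
  simp [peelRight]

theorem peelRight_mul_ι (c : TensorAlgebra ℂ V) (g : V →ₗ[ℂ] TensorAlgebra ℂ V) (v : V)
    (w : TensorAlgebra ℂ V) : peelRight c g (w * TensorAlgebra.ι ℂ v) = w * g v := by
  have h := peelRightAux_fst g w (1, c)
  simp only [one_mul] at h
  have h2 : ∀ p, ((peelRightAux g (TensorAlgebra.ι ℂ v)).unop p).2 = p.1 * g v := by
    intro p; simp [peelRightAux]
  simp [peelRight, h2, h]

end Peel

/-- The left action of `T ∈ 𝓛(X^δ)` on tensor words: `T` acts on the first letter if that letter has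
shade `δ`, and otherwise on a state-vector `ξ^δ` put in front of the word. -/
noncomputable def leftAct (δ : Shade) (T : Module.End ℂ (X δ)) : Full X →ₗ[ℂ] Full X :=
  peelLeft (embed δ (T (X δ).vec))
    (embed δ ∘ₗ T ∘ₗ (X δ).kernel.subtype ∘ₗ LinearMap.proj δ +
      LinearMap.mulLeft ℂ (embed δ (T (X δ).vec)) ∘ₗ letter δ.other ∘ₗ LinearMap.proj δ.other)

/-- The right action of `T ∈ 𝓛(X^δ)` on tensor words: `T` acts on the last letter if that letter has
shade `δ`, and otherwise on a state-vector `ξ^δ` put behind the word. -/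
noncomputable def rightAct (δ : Shade) (T : Module.End ℂ (X δ)) : Full X →ₗ[ℂ] Full X :=
  peelRight (embed δ (T (X δ).vec))
    (embed δ ∘ₗ T ∘ₗ (X δ).kernel.subtype ∘ₗ LinearMap.proj δ +
      LinearMap.mulRight ℂ (embed δ (T (X δ).vec)) ∘ₗ letter δ.other ∘ₗ LinearMap.proj δ.other)

theorem leftAct_one (δ : Shade) (T : Module.End ℂ (X δ)) :
    leftAct δ T 1 = embed δ (T (X δ).vec) := peelLeft_one _ _

theorem rightAct_one (δ : Shade) (T : Module.End ℂ (X δ)) :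
    rightAct δ T 1 = embed δ (T (X δ).vec) := peelRight_one _ _

theorem leftAct_same (δ : Shade) (T : Module.End ℂ (X δ)) (x : (X δ).kernel) (w : Full X) :
    leftAct δ T (letter δ x * w) = embed δ (T x) * w := by
  have h : (Pi.single δ x : Letters X) δ.other = 0 := by cases δ <;> rfl
  simp [leftAct, letter, peelLeft_ι_mul, h]

theorem leftAct_other (δ : Shade) (T : Module.End ℂ (X δ)) (x : (X δ.other).kernel)
    (w : Full X) :
    leftAct δ T (letter δ.other x * w) = embed δ (T (X δ).vec) * (letter δ.other x * w) := by
  have h : (Pi.single δ.other x : Letters X) δ = 0 := by cases δ <;> rfl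
  simp [leftAct, letter, peelLeft_ι_mul, h, mul_assoc]

theorem rightAct_same (δ : Shade) (T : Module.End ℂ (X δ)) (x : (X δ).kernel) (w : Full X) :
    rightAct δ T (w * letter δ x) = w * embed δ (T x) := by
  have h : (Pi.single δ x : Letters X) δ.other = 0 := by cases δ <;> rfl
  simp [rightAct, letter, peelRight_mul_ι, h]

theorem rightAct_other (δ : Shade) (T : Module.End ℂ (X δ)) (x : (X δ.other).kernel)
    (w : Full X) :
    rightAct δ T (w * letter δ.other x) = w * letter δ.other x * embed δ (T (X δ).vec) := by
  have h : (Pi.single δ.other x : Letters X) δ = 0 := by cases δ <;> rfl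
  simp [rightAct, letter, peelRight_mul_ι, h, mul_assoc]

theorem embed_mul_word_mem (δ : Shade) (y : X δ) (l : List ((δ : Shade) × (X δ).kernel))
    (h : ∀ x, IsAlternating (⟨δ, x⟩ :: l)) : embed δ y * word l ∈ alternating X := by
  have e : embed δ y * word l
      = (X δ).state y • word l + word (⟨δ, (X δ).center y⟩ :: l) := by
    simp [embed, word, add_mul]
  rw [e]
  exact Submodule.add_mem _ (Submodule.smul_mem _ _ (word_mem (h 0).tail)) (word_mem (h _))

theorem word_mul_embed_mem (δ : Shade) (y : X δ) (l : List ((δ : Shade) × (X δ).kernel))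
    (h : ∀ x, IsAlternating (l ++ [⟨δ, x⟩])) : word l * embed δ y ∈ alternating X := by
  have e : word l * embed δ y
      = (X δ).state y • word l + word (l ++ [⟨δ, (X δ).center y⟩]) := by
    simp [embed, word, mul_add]
  rw [e]
  exact Submodule.add_mem _
    (Submodule.smul_mem _ _ (word_mem (List.isChain_append.1 (h 0)).1)) (word_mem (h _))

theorem shade_cases (δ η : Shade) : η = δ ∨ η = δ.other := by
  cases δ <;> cases η <;> simp [Shade.other]

theorem ne_other (δ : Shade) : δ ≠ δ.other := by cases δ <;> simp [Shade.other]

theorem leftAct_mem (δ : Shade) (T : Module.End ℂ (X δ)) :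
    ∀ w ∈ alternating X, leftAct δ T w ∈ alternating X := by
  intro w hw
  refine (Submodule.span_le (p := (alternating X).comap (leftAct δ T))).2 ?_ hw
  rintro _ ⟨l, hl, rfl⟩
  show leftAct δ T (word l) ∈ alternating X
  rcases l with _ | ⟨⟨η, x⟩, l⟩
  · have := embed_mul_word_mem δ (T (X δ).vec) [] (fun x => List.isChain_singleton _)
    simpa [word, leftAct_one] using this
  · rcases shade_cases δ η with rfl | rfl
    · have := embed_mul_word_mem η (T x) l (fun y => by
        rcases l with _ | ⟨b, l⟩
        · exact List.isChain_singleton _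
        · exact List.isChain_cons_cons.2 (List.isChain_cons_cons.1 hl))
      simpa [word, leftAct_same] using this
    · have := embed_mul_word_mem δ (T (X δ).vec) (⟨δ.other, x⟩ :: l) (fun y =>
        List.isChain_cons_cons.2 ⟨ne_other δ, hl⟩)
      simpa [word, leftAct_other] using this

theorem rightAct_mem (δ : Shade) (T : Module.End ℂ (X δ)) :
    ∀ w ∈ alternating X, rightAct δ T w ∈ alternating X := by
  intro w hw
  refine (Submodule.span_le (p := (alternating X).comap (rightAct δ T))).2 ?_ hw
  rintro _ ⟨l, hl, rfl⟩
  show rightAct δ T (word l) ∈ alternating X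
  rcases List.eq_nil_or_concat l with rfl | ⟨l, ⟨η, x⟩, rfl⟩
  · have := word_mul_embed_mem δ (T (X δ).vec) [] (fun x => List.isChain_singleton _)
    simpa [word, rightAct_one] using this
  · rw [List.concat_eq_append] at hl ⊢
    rcases shade_cases δ η with rfl | rfl
    · have := word_mul_embed_mem η (T x) l (fun y => by
        have h := List.isChain_append.1 hl
        refine List.isChain_append.2 ⟨h.1, List.isChain_singleton _, ?_⟩
        intro a ha b hb
        have := h.2.2 a ha _ rfl
        simp only [List.head?_cons, Option.mem_def, Option.some.injEq] at hb
        subst hb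
        exact this)
      simpa [word, rightAct_same] using this
    · have := word_mul_embed_mem δ (T (X δ).vec) (l ++ [⟨δ.other, x⟩]) (fun y => by
        refine List.isChain_append.2 ⟨hl, List.isChain_singleton _, ?_⟩
        intro a ha b hb
        simp only [List.getLast?_append, List.getLast?_singleton, Option.some_or,
          List.head?_cons, Option.mem_def, Option.some.injEq] at ha hb
        subst ha hb
        exact (ne_other δ).symm)
      simpa [word, rightAct_other, mul_assoc] using this

variable (X)

/-- The left representation `λ^δ` of `𝓛(X^δ)` on the free product. -/
noncomputable def leftRep (δ : Shade) (T : Module.End ℂ (X δ)) :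
    Module.End ℂ (freeProduct X) :=
  (leftAct δ T).restrict (p := alternating X) (q := alternating X) (leftAct_mem δ T)

/-- The right representation `ρ^δ` of `𝓛(X^δ)` on the free product. -/
noncomputable def rightRep (δ : Shade) (T : Module.End ℂ (X δ)) :
    Module.End ℂ (freeProduct X) :=
  (rightAct δ T).restrict (p := alternating X) (q := alternating X) (rightAct_mem δ T)

end FreeProd

/-! ### Bi-free independence -/

/-- The joint distribution of a family `a` in `(A, φ)`: the functional `P ↦ φ (P(a))` on
noncommutative polynomials. -/
noncomputable def jointDistribution {A K : Type*} [Ring A] [Algebra ℂ A] (φ : A →ₗ[ℂ] ℂ)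
    (a : K → A) : FreeAlgebra ℂ K →ₗ[ℂ] ℂ :=
  φ ∘ₗ (FreeAlgebra.lift ℂ a).toLinearMap

/-- Bi-free independence of the two-faced families `z' = z .prime` and `z'' = z .dprime`. -/
def BiFree {I : Type u} {J : Type v} {A : Type w} [Ring A] [Algebra ℂ A] (φ : A →ₗ[ℂ] ℂ)
    (z : Shade → I ⊕ J → A) : Prop :=
  ∃ (X : Shade → StateVectorSpace.{x})
    (l : (δ : Shade) → FreeAlgebra ℂ I →ₐ[ℂ] Module.End ℂ (X δ))
    (r : (δ : Shade) → FreeAlgebra ℂ J →ₐ[ℂ] Module.End ℂ (X δ)),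
    jointDistribution (FreeProd.freeProduct X).vacuumState
        (fun p : Shade × (I ⊕ J) => Sum.elim
          (fun i => FreeProd.leftRep X p.1 (l p.1 (FreeAlgebra.ι ℂ i)))
          (fun j => FreeProd.rightRep X p.1 (r p.1 (FreeAlgebra.ι ℂ j))) p.2) =
      jointDistribution φ (fun p : Shade × (I ⊕ J) => z p.1 p.2)

/-! ### Bi-non-crossing partitions -/

/-- The family of blocks `B` has no crossing: there are no `a < b < c < d` with `a, c` in one block
and `b, d` in another one. -/
def IsNonCrossing {n : ℕ} (B : Finset (Finset (Fin n))) : Prop :=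
  ∀ V ∈ B, ∀ W ∈ B, ∀ a b c d : Fin n, a < b → b < c → c < d →
    a ∈ V → c ∈ V → b ∈ W → d ∈ W → V = W

section BNC

variable {I J : Type*} {n : ℕ}

/-- Sorting by this key puts the left nodes first, in increasing order, and then the right nodes,
in decreasing order. -/
def sideKey (α : Fin n → I ⊕ J) (k : Fin n) : ℕ :=
  if (α k).isLeft then (k : ℕ) else 2 * n - (k : ℕ)

/-- The permutation `s_α` with `s_α(1), …, s_α(n) = i₁, …, i_p, j_{n-p}, …, j₁`, where
`i₁ < ⋯ < i_p` are the left nodes and `j₁ < ⋯ < j_{n-p}` the right nodes. -/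
def sidePerm (α : Fin n → I ⊕ J) : Equiv.Perm (Fin n) := Tuple.sort (sideKey α)

theorem sideKey_injective (α : Fin n → I ⊕ J) : Function.Injective (sideKey α) := by
  intro a b h
  have ha := a.2
  have hb := b.2
  apply Fin.ext
  unfold sideKey at h
  split_ifs at h <;> omega

theorem sidePerm_strictMono (α : Fin n → I ⊕ J) : StrictMono (sideKey α ∘ sidePerm α) :=
  (Tuple.monotone_sort (sideKey α)).strictMono_of_injective
    ((sideKey_injective α).comp (sidePerm α).injective)

/-- Partitions of the set of nodes, ordered by refinement. -/
abbrev NodePartition (n : ℕ) := Finpartition (Finset.univ : Finset (Fin n))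

/-- The partition `π` is bi-non-crossing: `s_α⁻¹ · π` is non-crossing. -/
def IsBiNonCrossing (α : Fin n → I ⊕ J) (π : NodePartition n) : Prop :=
  IsNonCrossing (π.parts.image (Finset.image (sidePerm α).symm))

/-- The set `BNC(α)`, ordered by refinement. -/
abbrev BNC (α : Fin n → I ⊕ J) := {π : NodePartition n // IsBiNonCrossing α π}

noncomputable instance (α : Fin n → I ⊕ J) : Fintype (BNC α) := Fintype.ofFinite _

open Classical in
noncomputable instance (α : Fin n → I ⊕ J) : LocallyFiniteOrder (BNC α) :=
  Fintype.toLocallyFiniteOrder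

/-- The Möbius function `μ_BNC` on `BNC(α)`. -/
noncomputable def muBNC (α : Fin n → I ⊕ J) (π σ : BNC α) : ℂ :=
  IncidenceAlgebra.mu ℂ π σ

/-- The partition of the nodes induced by a shading: nodes of equal shade form a block. -/
def shadePartition (ε : Fin n → Shade) : NodePartition n :=
  letI : DecidableRel (Setoid.ker ε).r := fun a b => inferInstanceAs (Decidable (ε a = ε b))
  Finpartition.ofSetoid (Setoid.ker ε)

/-! ### The polynomials -/

/-- The indeterminates `X'_K` and `X''_K`, with `K` a non-empty subset of the nodes. -/
abbrev Indet (n : ℕ) := Shade × {K : Finset (Fin n) // K.Nonempty}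

/-- The shade `ε(V)` of the least node of `V`; it is the common shade of the nodes of `V` whenever
`V` is a block of a partition `π ≤ ε`. -/
def blockShade (ε : Fin n → Shade) (V : {K : Finset (Fin n) // K.Nonempty}) : Shade :=
  ε (V.1.min' V.2)

/-- A block of a partition as a non-empty set of nodes. -/
def blockSet (π : NodePartition n) (V : {V // V ∈ π.parts}) :
    {K : Finset (Fin n) // K.Nonempty} :=
  ⟨V.1, π.nonempty_of_mem_parts V.2⟩

open Classical in
/-- `P_{α,ε} = ∑_{π ∈ BNC(α), π ≤ ε} [∑_{σ ∈ BNC(α), π ≤ σ ≤ ε} μ_BNC(π,σ)] ∏_{V ∈ π} X_V^{ε(V)}`. -/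
noncomputable def momentPoly (α : Fin n → I ⊕ J) (ε : Fin n → Shade) :
    MvPolynomial (Indet n) ℂ :=
  ∑ π : BNC α with π.1 ≤ shadePartition ε,
    MvPolynomial.C (∑ σ : BNC α with π ≤ σ ∧ σ.1 ≤ shadePartition ε, muBNC α π σ) *
      ∏ V ∈ π.1.parts.attach, MvPolynomial.X (blockShade ε (blockSet π.1 V), blockSet π.1 V)

/-- `Q_α`, the sum of the `P_{α,ε}` over all shadings `ε`. -/
noncomputable def sumPoly (α : Fin n → I ⊕ J) : MvPolynomial (Indet n) ℂ :=
  ∑ ε : Fin n → Shade, momentPoly α ε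

/-! ### Moments -/

/-- `φ (a₁ a₂ ⋯ aₙ)`. -/
def orderedMoment {A : Type*} [Ring A] [Algebra ℂ A] (φ : A →ₗ[ℂ] ℂ) (a : Fin n → A) : ℂ :=
  φ (List.ofFn a).prod

/-- The point `X^δ_{k₁ < ⋯ < k_r} = φ (z^δ_{α(k₁)} ⋯ z^δ_{α(k_r)})`. -/
def momentPoint {A : Type*} [Ring A] [Algebra ℂ A] (φ : A →ₗ[ℂ] ℂ)
    (z : Shade → I ⊕ J → A) (α : Fin n → I ⊕ J) : Indet n → ℂ :=
  fun p => φ ((p.2.1.sort (· ≤ ·)).map fun k => z p.1 (α k)).prod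

end BNC

/-! Ordered by `sideKey`, the nodes form a line on which `BNC α` becomes the set of ordinary
non-crossing partitions. The heart of the proof is a moment-cumulant formula: a mixed moment in the
free product is the sum, over non-crossing partitions in this order, of products of cumulants, where
a set carrying two shades has cumulant zero (`wordMoment_eq_ncSum`).

Neither side of that formula is computed outright; both solve the same recursion. Cut a set `K` of
nodes into its maximal intervals of equal shade. For each set `F` of intervals, delete these
intervals, multiply by their moments and by `(-1) ^ F.card`, and sum over `F`. This sum vanishes for
both sides. The term `F = ∅` is the value at `K` and every other term involves a proper subset of
`K`, so induction gives equality (`eq_of_altSum_eq`).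

For operators: left nodes act on the first tensor factor and right nodes on the last, so the product
builds a tensor whose factors follow the `sideKey` order, one per interval. The alternating sum
centres every factor (`altSum_wordVec`), and the state kills the result.

For partitions: the alternating sum is an inclusion-exclusion over the intervals that are unions of
blocks. A non-crossing partition with blocks of constant shade always has such an interval
(`IsNCPartition.exists_level`), so its coefficients cancel (`altSum_ncSum`).

It remains to compare with the polynomials. The product of the moments over the blocks of `π` is the
sum of cumulant products over all `τ ≤ π`, and the bracket of Möbius values in the polynomial
inverts this summation (`eval_momentPoly`). For a constant shading the bracket vanishes except at
the one-block partition, which gives the two linear terms of `sumPoly`. -/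

/-! ### Weighted sums over non-crossing partitions, and cumulants -/

section NonCrossingSums

variable {N : Type*} (pos : N → ℕ)

/-- There are `a < b < c < d` with `a, c ∈ V` and `b, d ∈ W`, in the order given by `pos`. -/
def Crosses (V W : Finset N) : Prop :=
  ∃ a ∈ V, ∃ b ∈ W, ∃ c ∈ V, ∃ d ∈ W, pos a < pos b ∧ pos b < pos c ∧ pos c < pos d

variable {pos} in
theorem Crosses.mono {V W V' W' : Finset N} (h : Crosses pos V W) (hV : V ⊆ V') (hW : W ⊆ W') :
    Crosses pos V' W' := by
  obtain ⟨a, ha, b, hb, c, hc, d, hd, h⟩ := h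
  exact ⟨a, hV ha, b, hW hb, c, hV hc, d, hW hd, h⟩

/-- `B` is a non-crossing partition of `K` into non-empty blocks. -/
structure IsNCPartition (K : Finset N) (B : Finset (Finset N)) : Prop where
  nonempty : ∀ W ∈ B, W.Nonempty
  eq_of_mem : ∀ V ∈ B, ∀ W ∈ B, ∀ k, k ∈ V → k ∈ W → V = W
  cover : ∀ k, k ∈ K ↔ ∃ W ∈ B, k ∈ W
  nonCrossing : ∀ V ∈ B, ∀ W ∈ B, Crosses pos V W → V = W

variable {pos} in
theorem IsNCPartition.subset {K : Finset N} {B : Finset (Finset N)} (h : IsNCPartition pos K B)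
    {W : Finset N} (hW : W ∈ B) : W ⊆ K := fun k hk => (h.cover k).2 ⟨W, hW, hk⟩

variable [Fintype N]

open Classical in
/-- The non-crossing partitions of `K`. -/
noncomputable def ncParts (K : Finset N) : Finset (Finset (Finset N)) :=
  Finset.univ.filter (IsNCPartition pos K)

theorem mem_ncParts {K : Finset N} {B : Finset (Finset N)} :
    B ∈ ncParts pos K ↔ IsNCPartition pos K B := by simp [ncParts]

/-- The sum over the non-crossing partitions of `K` of the product of the weights of the blocks. -/
noncomputable def ncSum (g : Finset N → ℂ) (K : Finset N) : ℂ :=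
  ∑ B ∈ ncParts pos K, ∏ W ∈ B, g W

theorem ncSum_empty (g : Finset N → ℂ) : ncSum pos g ∅ = 1 := by
  have : ncParts pos (∅ : Finset N) = {∅} := by
    ext B
    rw [mem_ncParts, Finset.mem_singleton]
    constructor
    · intro h
      rw [Finset.eq_empty_iff_forall_notMem]
      intro W hW
      obtain ⟨k, hk⟩ := h.nonempty W hW
      simpa using h.subset hW hk
    · rintro rfl
      constructor <;> simp
  simp [ncSum, this]

theorem ncSum_congr {g g' : Finset N → ℂ} {K : Finset N}
    (h : ∀ W ⊆ K, W.Nonempty → g W = g' W) : ncSum pos g K = ncSum pos g' K := by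
  refine Finset.sum_congr rfl fun B hB => Finset.prod_congr rfl fun W hW => ?_
  rw [mem_ncParts] at hB
  exact h W (hB.subset hW) (hB.nonempty W hW)

variable [DecidableEq N]

/-- Only partitions whose blocks all lie in `U` or in its complement contribute, and such a
partition is an independent choice of partitions of the two parts, since no crossing arises between
them. -/
theorem ncSum_split {g : Finset N → ℂ} {U K : Finset N} (hU : U ⊆ K)
    (h1 : ∀ W ⊆ K, W.Nonempty → g W ≠ 0 → W ⊆ U ∨ Disjoint W U)
    (h2 : ∀ V ⊆ U, ∀ W ⊆ K \ U, W.Nonempty → g V ≠ 0 → g W ≠ 0 →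
      ¬ Crosses pos V W ∧ ¬ Crosses pos W V) :
    ncSum pos g K = ncSum pos g U * ncSum pos g (K \ U) := by
  classical
  unfold ncSum
  rw [Finset.sum_mul_sum, ← Finset.sum_product']
  have disj : ∀ {B C : Finset (Finset N)}, IsNCPartition pos U B → IsNCPartition pos (K \ U) C →
      ∀ V ∈ B, ∀ W ∈ C, ∀ k, k ∈ V → k ∈ W → False := by
    intro B C hB hC V hV W hW k hk hk'
    exact (Finset.mem_sdiff.1 (hC.subset hW hk')).2 (hB.subset hV hk)
  have disjB : ∀ {B C : Finset (Finset N)}, IsNCPartition pos U B → IsNCPartition pos (K \ U) C →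
      Disjoint B C := by
    intro B C hB hC
    rw [Finset.disjoint_left]
    intro W hW hW'
    obtain ⟨k, hk⟩ := hB.nonempty W hW
    exact disj hB hC W hW W hW' k hk hk
  symm
  -- Only non-zero terms are matched, because `h1` and `h2` speak only of sets with non-zero weight.
  refine Finset.sum_bij_ne_zero (fun p _ _ => p.1 ∪ p.2) ?_ ?_ ?_ ?_
  · rintro ⟨B, C⟩ hp hne
    simp only [Finset.mem_product, mem_ncParts] at hp hne ⊢
    obtain ⟨hB, hC⟩ := hp
    have hgB := Finset.prod_ne_zero_iff.1 (left_ne_zero_of_mul hne)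
    have hgC := Finset.prod_ne_zero_iff.1 (right_ne_zero_of_mul hne)
    constructor
    · intro W hW
      rcases Finset.mem_union.1 hW with h | h
      exacts [hB.nonempty W h, hC.nonempty W h]
    · intro V hV W hW k hkV hkW
      rcases Finset.mem_union.1 hV with h | h <;> rcases Finset.mem_union.1 hW with h' | h'
      · exact hB.eq_of_mem V h W h' k hkV hkW
      · exact (disj hB hC V h W h' k hkV hkW).elim
      · exact (disj hB hC W h' V h k hkW hkV).elim
      · exact hC.eq_of_mem V h W h' k hkV hkW
    · intro k
      have e1 := hB.cover k
      have e2 := hC.cover k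
      rw [Finset.mem_sdiff] at e2
      have := @hU k
      simp only [Finset.mem_union, or_and_right, exists_or]
      rw [← e1, ← e2]
      tauto
    · intro V hV W hW hc
      rcases Finset.mem_union.1 hV with h | h <;> rcases Finset.mem_union.1 hW with h' | h'
      · exact hB.nonCrossing V h W h' hc
      · exact ((h2 V (hB.subset h) W (hC.subset h') (hC.nonempty W h') (hgB V h)
          (hgC W h')).1 hc).elim
      · exact ((h2 W (hB.subset h') V (hC.subset h) (hC.nonempty V h) (hgB W h')
          (hgC V h)).2 hc).elim
      · exact hC.nonCrossing V h W h' hc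
  · rintro ⟨B, C⟩ hp - ⟨B', C'⟩ hp' - h
    simp only [Finset.mem_product, mem_ncParts] at hp hp' h
    have key : ∀ {B C B' C' : Finset (Finset N)}, IsNCPartition pos U B →
        IsNCPartition pos (K \ U) C → IsNCPartition pos U B' →
        IsNCPartition pos (K \ U) C' → B ∪ C = B' ∪ C' → B ⊆ B' ∧ C ⊆ C' := by
      intro B C B' C' hB hC hB' hC' h
      constructor
      · intro W hW
        have : W ∈ B' ∪ C' := h ▸ Finset.mem_union_left _ hW
        rcases Finset.mem_union.1 this with h' | h'
        · exact h'
        · obtain ⟨k, hk⟩ := hB.nonempty W hW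
          exact (disj hB hC' W hW W h' k hk hk).elim
      · intro W hW
        have : W ∈ B' ∪ C' := h ▸ Finset.mem_union_right _ hW
        rcases Finset.mem_union.1 this with h' | h'
        · obtain ⟨k, hk⟩ := hC.nonempty W hW
          exact (disj hB' hC W h' W hW k hk hk).elim
        · exact h'
    have k1 := key hp.1 hp.2 hp'.1 hp'.2 h
    have k2 := key hp'.1 hp'.2 hp.1 hp.2 h.symm
    exact Prod.ext (k1.1.antisymm k2.1) (k1.2.antisymm k2.2)
  · intro B hB hne
    rw [mem_ncParts] at hB
    have hg := Finset.prod_ne_zero_iff.1 hne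
    have hd : ∀ W ∈ B, W ⊆ U ∨ Disjoint W U := fun W hW =>
      h1 W (hB.subset hW) (hB.nonempty W hW) (hg W hW)
    refine ⟨(B.filter (· ⊆ U), B.filter (¬ · ⊆ U)), ?_, ?_, ?_⟩
    · simp only [Finset.mem_product, mem_ncParts]
      constructor
      · constructor
        · exact fun W hW => hB.nonempty W (Finset.mem_filter.1 hW).1
        · exact fun V hV W hW => hB.eq_of_mem V (Finset.mem_filter.1 hV).1 W
            (Finset.mem_filter.1 hW).1
        · intro k
          constructor
          · intro hk
            obtain ⟨W, hW, hkW⟩ := (hB.cover k).1 (hU hk)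
            refine ⟨W, Finset.mem_filter.2 ⟨hW, (hd W hW).resolve_right fun h => ?_⟩, hkW⟩
            exact Finset.disjoint_left.1 h hkW hk
          · rintro ⟨W, hW, hkW⟩
            exact (Finset.mem_filter.1 hW).2 hkW
        · exact fun V hV W hW => hB.nonCrossing V (Finset.mem_filter.1 hV).1 W
            (Finset.mem_filter.1 hW).1
      · constructor
        · exact fun W hW => hB.nonempty W (Finset.mem_filter.1 hW).1
        · exact fun V hV W hW => hB.eq_of_mem V (Finset.mem_filter.1 hV).1 W
            (Finset.mem_filter.1 hW).1
        · intro k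
          rw [Finset.mem_sdiff]
          constructor
          · rintro ⟨hk, hkU⟩
            obtain ⟨W, hW, hkW⟩ := (hB.cover k).1 hk
            exact ⟨W, Finset.mem_filter.2 ⟨hW, fun h => hkU (h hkW)⟩, hkW⟩
          · rintro ⟨W, hW, hkW⟩
            obtain ⟨hW, hWU⟩ := Finset.mem_filter.1 hW
            exact ⟨hB.subset hW hkW, Finset.disjoint_left.1 ((hd W hW).resolve_left hWU) hkW⟩
        · exact fun V hV W hW => hB.nonCrossing V (Finset.mem_filter.1 hV).1 W
            (Finset.mem_filter.1 hW).1
    · simp only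
      rwa [Finset.prod_filter_mul_prod_filter_not]
    · simp only
      exact Finset.filter_union_filter_not_eq _ _
  · rintro ⟨B, C⟩ hp -
    simp only [Finset.mem_product, mem_ncParts] at hp ⊢
    rw [Finset.prod_union (disjB hp.1 hp.2)]

/-- If the weights of sets which are not contained in a block of the non-crossing partition `D`
vanish, then the sum over all non-crossing partitions is a product over the blocks of `D`. -/
theorem ncSum_eq_prod {g : Finset N → ℂ} {K : Finset N} {D : Finset (Finset N)}
    (hD : IsNCPartition pos K D) (hg : ∀ W ⊆ K, W.Nonempty → g W ≠ 0 → ∃ V ∈ D, W ⊆ V) :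
    ncSum pos g K = ∏ V ∈ D, ncSum pos g V := by
  classical
  induction D using Finset.induction_on generalizing K with
  | empty =>
    have : K = ∅ := by
      rw [Finset.eq_empty_iff_forall_notMem]
      intro k hk
      simpa using (hD.cover k).1 hk
    simp [this, ncSum_empty]
  | insert U D hUD ih =>
    have hUi := Finset.mem_insert_self U D
    have hU : U ⊆ K := hD.subset hUi
    have hdis : ∀ V ∈ D, ∀ k, k ∈ V → k ∉ U := fun V hV k hk hkU =>
      hUD (hD.eq_of_mem V (Finset.mem_insert_of_mem hV) U hUi k hk hkU ▸ hV)
    have hD' : IsNCPartition pos (K \ U) D := by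
      constructor
      · exact fun W hW => hD.nonempty W (Finset.mem_insert_of_mem hW)
      · exact fun V hV W hW =>
          hD.eq_of_mem V (Finset.mem_insert_of_mem hV) W (Finset.mem_insert_of_mem hW)
      · intro k
        rw [Finset.mem_sdiff, hD.cover k]
        constructor
        · rintro ⟨⟨W, hW, hk⟩, hkU⟩
          rcases Finset.mem_insert.1 hW with rfl | hW
          · exact (hkU hk).elim
          · exact ⟨W, hW, hk⟩
        · rintro ⟨W, hW, hk⟩
          exact ⟨⟨W, Finset.mem_insert_of_mem hW, hk⟩, hdis W hW k hk⟩
      · exact fun V hV W hW =>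
          hD.nonCrossing V (Finset.mem_insert_of_mem hV) W (Finset.mem_insert_of_mem hW)
    have hin : ∀ W ⊆ K \ U, W.Nonempty → g W ≠ 0 → ∃ V ∈ D, W ⊆ V := by
      intro W hW hne hgW
      obtain ⟨V, hV, hWV⟩ := hg W (hW.trans Finset.sdiff_subset) hne hgW
      rcases Finset.mem_insert.1 hV with rfl | hV
      · obtain ⟨k, hk⟩ := hne
        exact ((Finset.mem_sdiff.1 (hW hk)).2 (hWV hk)).elim
      · exact ⟨V, hV, hWV⟩
    -- Blocks of `D` are split off one at a time; `D` being non-crossing supplies the absence of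
    -- crossings between subsets of different blocks.
    rw [Finset.prod_insert hUD, ncSum_split pos hU, ih hD' hin]
    · intro W hW hne hgW
      obtain ⟨V, hV, hWV⟩ := hg W hW hne hgW
      rcases Finset.mem_insert.1 hV with rfl | hV
      · exact Or.inl hWV
      · exact Or.inr (Finset.disjoint_left.2 fun k hk => hdis V hV k (hWV hk))
    · intro V hV W hW hneW _ hgW
      obtain ⟨V', hV', hWV'⟩ := hin W hW hneW hgW
      have hne : V' ≠ U := fun h => hUD (h ▸ hV')
      exact ⟨fun h => hne (hD.nonCrossing U hUi V' (Finset.mem_insert_of_mem hV')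
        (h.mono hV hWV')).symm,
        fun h => hne (hD.nonCrossing V' (Finset.mem_insert_of_mem hV') U hUi (h.mono hWV' hV))⟩

/-- The cumulants of the moments `m`, defined by `ncSum_cumulant`. -/
noncomputable def cumulant (m : Finset N → ℂ) (K : Finset N) : ℂ :=
  m K - ∑ B ∈ (ncParts pos K).erase {K},
    ∏ V ∈ B, if _h : V.card < K.card then cumulant m V else 0
termination_by K.card

theorem ncSum_cumulant (m : Finset N → ℂ) {K : Finset N} (hK : K.Nonempty) :
    ncSum pos (cumulant pos m) K = m K := by
  have hmem : {K} ∈ ncParts pos K := by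
    rw [mem_ncParts]
    constructor <;> simp_all
  rw [ncSum, ← Finset.add_sum_erase _ _ hmem, Finset.prod_singleton]
  conv_lhs => enter [1]; rw [cumulant]
  rw [sub_add_eq_add_sub, sub_eq_iff_eq_add]
  congr 1
  refine Finset.sum_congr rfl fun B hB => Finset.prod_congr rfl fun W hW => ?_
  obtain ⟨hne, hB⟩ := Finset.mem_erase.1 hB
  rw [mem_ncParts] at hB
  -- A block of a partition other than `{K}` is a proper subset of `K`, so the value 0 that secures
  -- termination in `cumulant` is never taken here.
  rw [dif_pos]
  refine Finset.card_lt_card ((hB.subset hW).ssubset_of_ne ?_)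
  rintro rfl
  refine hne (Finset.eq_singleton_iff_unique_mem.2 ⟨hW, fun V hV => ?_⟩)
  obtain ⟨k, hk⟩ := hB.nonempty V hV
  exact hB.eq_of_mem V hV W hW k hk (hB.subset hV hk)

end NonCrossingSums

/-! ### Alternating sums over maximal intervals of equal shade -/

section Intervals

variable {N : Type*}

/-- The alternating sum over the ways to split off from `K` some of the level sets of `ι` with
levels in `C`, where splitting off the level set `S` of `i` contributes the factor `c i S`. -/
noncomputable def altSum {E : Type*} [AddCommGroup E] [Module ℂ E] (ι : N → ℕ)
    (c : ℕ → Finset N → ℂ) (f : Finset N → E) (C : Finset ℕ) (K : Finset N) : E :=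
  ∑ F ∈ C.powerset, ((-1) ^ F.card * ∏ i ∈ F, c i (K.filter (ι · = i))) • f (K.filter (ι · ∉ F))

/-- Separate the sets `F` by whether they contain `i`. Deleting the level `i` does not change the
other level sets, so the terms containing `i` form an alternating sum over the smaller set of nodes.
-/
theorem altSum_insert {E : Type*} [AddCommGroup E] [Module ℂ E] (ι : N → ℕ)
    (c : ℕ → Finset N → ℂ) (f : Finset N → E) {C : Finset ℕ} {i : ℕ} (hi : i ∉ C) (K : Finset N) :
    altSum ι c f (insert i C) K =
      altSum ι c f C K - c i (K.filter (ι · = i)) • altSum ι c f C (K.filter (ι · ≠ i)) := by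
  unfold altSum
  rw [Finset.sum_powerset_insert hi, sub_eq_add_neg, Finset.smul_sum, ← Finset.sum_neg_distrib]
  congr 1
  refine Finset.sum_congr rfl fun F hF => ?_
  have hiF : i ∉ F := fun h => hi (Finset.mem_powerset.1 hF h)
  rw [Finset.card_insert_of_notMem hiF, Finset.prod_insert hiF, smul_smul, ← neg_smul]
  congr 1
  · have : ∏ j ∈ F, c j ((K.filter (ι · ≠ i)).filter (ι · = j)) =
        ∏ j ∈ F, c j (K.filter (ι · = j)) := by
      refine Finset.prod_congr rfl fun j hj => ?_
      congr 1
      ext k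
      simp only [Finset.mem_filter]
      have : j ≠ i := fun h => hiF (h ▸ hj)
      constructor
      · rintro ⟨⟨h1, -⟩, h2⟩
        exact ⟨h1, h2⟩
      · rintro ⟨h1, rfl⟩
        exact ⟨⟨h1, this⟩, rfl⟩
    rw [this]
    ring
  · congr 1
    ext k
    simp only [Finset.mem_filter, Finset.mem_insert]
    tauto

theorem map_altSum {E E' : Type*} [AddCommGroup E] [Module ℂ E] [AddCommGroup E'] [Module ℂ E']
    (L : E →ₗ[ℂ] E') (ι : N → ℕ) (c : ℕ → Finset N → ℂ) (f : Finset N → E) (C : Finset ℕ)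
    (K : Finset N) : L (altSum ι c f C K) = altSum ι c (fun S => L (f S)) C K := by
  simp [altSum, map_sum]

variable [DecidableEq N]

/-- The levels `0, 1, …` of `ι` on `K` are the maximal intervals of nodes of equal shade, where the
nodes are ordered by `pos`, and `δ i` is the shade of the `i`-th interval. -/
structure IsIntervalIndex (pos : N → ℕ) (ε : N → Shade) (K : Finset N) (ι : N → ℕ)
    (δ : ℕ → Shade) : Prop where
  mono : ∀ a ∈ K, ∀ b ∈ K, pos a ≤ pos b → ι a ≤ ι b
  shade : ∀ a ∈ K, ε a = δ (ι a)
  alternating : ∀ i, δ (i + 1) ≠ δ i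
  connected : ∀ a ∈ K, ∀ i ≤ ι a, ∃ b ∈ K, ι b = i

theorem Shade.eq_of_ne_of_ne {a b c : Shade} (h : a ≠ b) (h' : c ≠ b) : a = c := by
  cases a <;> cases b <;> cases c <;> simp_all

theorem exists_isIntervalIndex {pos : N → ℕ} (hpos : pos.Injective) (ε : N → Shade)
    (K : Finset N) : ∃ ι δ, IsIntervalIndex pos ε K ι δ := by
  -- The occupied levels are exactly those below `m`; the next node, with the largest position, thus
  -- joins the level `m - 1` or opens the level `m`.
  suffices h : ∃ ι δ m, IsIntervalIndex pos ε K ι δ ∧ (∀ a ∈ K, ι a < m) ∧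
      ∀ i < m, ∃ b ∈ K, ι b = i by
    obtain ⟨ι, δ, -, h, -⟩ := h
    exact ⟨ι, δ, h⟩
  induction K using Finset.induction_on_max_value pos with
  | empty =>
    refine ⟨fun _ => 0, fun i => if Even i then .prime else .dprime, 0, ⟨?_, ?_, ?_, ?_⟩, ?_, ?_⟩
    case refine_3 =>
      intro i
      by_cases h : Even i <;> simp [h, Nat.even_add_one]
    all_goals simp
  | insert a K ha hmax ih =>
    obtain ⟨ι, δ, m, h, hlt, hsurj⟩ := ih
    have hlast : ∀ j, m ≤ j + 1 → IsIntervalIndex pos ε (insert a K) (Function.update ι a j) δ →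
        j ≤ m → ∃ ι δ m, IsIntervalIndex pos ε (insert a K) ι δ ∧
        (∀ b ∈ insert a K, ι b < m) ∧ ∀ i < m, ∃ b ∈ insert a K, ι b = i := by
      intro j hj hI hjm
      refine ⟨_, δ, j + 1, hI, ?_, ?_⟩
      · intro b hb
        rcases Finset.mem_insert.1 hb with rfl | hb
        · simp
        · have hba : b ≠ a := fun h => ha (h ▸ hb)
          rw [Function.update_of_ne hba]
          exact (hlt b hb).trans_le hj
      · intro i hi
        refine hI.connected a (Finset.mem_insert_self _ _) i ?_
        simpa using Nat.lt_succ_iff.1 hi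
    have build : ∀ (δ' : ℕ → Shade) (j : ℕ), (∀ i, δ' (i + 1) ≠ δ' i) →
        (∀ b ∈ K, ε b = δ' (ι b)) → ε a = δ' j → m ≤ j + 1 → j ≤ m →
        IsIntervalIndex pos ε (insert a K) (Function.update ι a j) δ' := by
      intro δ' j h1 h2 h3 h4 h5
      have hne : ∀ b ∈ K, b ≠ a := fun b hb h => ha (h ▸ hb)
      constructor
      · intro b hb c hc hbc
        rcases Finset.mem_insert.1 hb with hb' | hb' <;>
          rcases Finset.mem_insert.1 hc with hc' | hc'
        · rw [hb', hc']
        · rw [hb'] at hbc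
          exact (hne c hc' (hpos (le_antisymm (hmax c hc') hbc))).elim
        · have := hlt b hb'
          rw [hc', Function.update_self, Function.update_of_ne (hne b hb')]
          omega
        · rw [Function.update_of_ne (hne b hb'), Function.update_of_ne (hne c hc')]
          exact h.mono b hb' c hc' hbc
      · intro b hb
        rcases Finset.mem_insert.1 hb with rfl | hb
        · simpa using h3
        · rw [Function.update_of_ne (hne b hb)]
          exact h2 b hb
      · exact h1
      · intro b hb i hi
        by_cases him : i < m
        · obtain ⟨c, hc, rfl⟩ := hsurj i him
          exact ⟨c, Finset.mem_insert_of_mem hc, Function.update_of_ne (hne c hc) _ _⟩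
        · refine ⟨a, Finset.mem_insert_self _ _, ?_⟩
          rcases Finset.mem_insert.1 hb with rfl | hb
          · simp only [Function.update_self] at hi ⊢
            omega
          · rw [Function.update_of_ne (hne b hb)] at hi
            have := hlt b hb
            omega
    rcases m with _ | q
    -- For the first node the sequence of shades is chosen afresh, to start with the shade of `a`.
    · have hK : ∀ b, b ∉ K := fun b hb => absurd (hlt b hb) (by simp)
      refine ⟨_, fun i => if Even i then ε a else (ε a).other, 1,
        build (fun i => if Even i then ε a else (ε a).other) 0 ?_ ?_ ?_ ?_ ?_, ?_, ?_⟩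
      · intro i
        have := FreeProd.ne_other (ε a)
        by_cases h : Even i <;> simp [h, Nat.even_add_one, this, this.symm]
      · exact fun b hb => (hK b hb).elim
      · simp
      · simp
      · simp
      · intro b hb
        rcases Finset.mem_insert.1 hb with rfl | hb
        · simp
        · exact (hK b hb).elim
      · intro i hi
        exact ⟨a, Finset.mem_insert_self _ _, by simp; omega⟩
    · by_cases hq : ε a = δ q
      · exact hlast q le_rfl (build δ q h.alternating h.shade hq le_rfl (by omega)) (by omega)
      -- With only two shades, `ε a` and `δ (q + 1)` agree because both differ from `δ q`.
      · exact hlast (q + 1) (by omega) (build δ (q + 1) h.alternating h.shade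
          (Shade.eq_of_ne_of_ne hq (h.alternating q)) (by omega) le_rfl) le_rfl

/-! ### Intervals that are unions of blocks -/

variable [Fintype N]

/-- The modified weight keeps just the partitions in which each level of `F` is a union of blocks. A
level is an interval of positions, so a set inside it cannot cross a set outside it, and
`ncSum_split` peels the levels off. -/
theorem ncSum_split_levels {pos : N → ℕ} {ι : N → ℕ} (g : Finset N → ℂ) (F : Finset ℕ)
    {K : Finset N} (hmono : ∀ a ∈ K, ∀ b ∈ K, pos a ≤ pos b → ι a ≤ ι b) :
    ncSum pos (fun W => if ∀ i ∈ F, (∀ k ∈ W, ι k = i) ∨ ∀ k ∈ W, ι k ≠ i then g W else 0) K =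
      (∏ i ∈ F, ncSum pos g (K.filter (ι · = i))) * ncSum pos g (K.filter (ι · ∉ F)) := by
  induction F using Finset.induction_on generalizing K with
  | empty => simp
  | insert i F hi ih =>
    have hsd : ∀ k, k ∈ K \ K.filter (ι · = i) ↔ k ∈ K ∧ ι k ≠ i := by
      intro k
      simp only [Finset.mem_sdiff, Finset.mem_filter]
      tauto
    rw [ncSum_split pos (Finset.filter_subset (ι · = i) K), Finset.prod_insert hi, mul_assoc]
    · congr 1
      · refine ncSum_congr pos fun W hW _ => ?_
        have hWi : ∀ k ∈ W, ι k = i := fun k hk => (Finset.mem_filter.1 (hW hk)).2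
        rw [if_pos]
        intro j hj
        by_cases hji : j = i
        · exact Or.inl (hji ▸ hWi)
        · exact Or.inr fun k hk => (hWi k hk).trans_ne (Ne.symm hji)
      · have e1 : ∀ j ∈ F, (K \ K.filter (ι · = i)).filter (ι · = j) = K.filter (ι · = j) := by
          intro j hj
          have hji : j ≠ i := fun h => hi (h ▸ hj)
          ext k
          rw [Finset.mem_filter, Finset.mem_filter, hsd]
          constructor
          · rintro ⟨⟨h1, -⟩, h2⟩
            exact ⟨h1, h2⟩
          · rintro ⟨h1, rfl⟩
            exact ⟨⟨h1, hji⟩, rfl⟩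
        have e2 : (K \ K.filter (ι · = i)).filter (ι · ∉ F) = K.filter (ι · ∉ insert i F) := by
          ext k
          rw [Finset.mem_filter, Finset.mem_filter, hsd, Finset.mem_insert]
          tauto
        have := ih (K := K \ K.filter (ι · = i)) fun a ha b hb =>
          hmono a (Finset.sdiff_subset ha) b (Finset.sdiff_subset hb)
        rw [Finset.prod_congr rfl fun j hj => congrArg (ncSum pos g) (e1 j hj), e2] at this
        rw [← this]
        refine ncSum_congr pos fun W hW _ => ?_
        have hWi : ∀ k ∈ W, ι k ≠ i := fun k hk => ((hsd k).1 (hW hk)).2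
        refine if_congr ?_ rfl rfl
        rw [Finset.forall_mem_insert]
        exact and_iff_right (Or.inr hWi)
    · intro W hW _ hg
      have := (ite_ne_right_iff.1 hg).1 i (Finset.mem_insert_self _ _)
      refine this.imp (fun h k hk => Finset.mem_filter.2 ⟨hW hk, h k hk⟩) fun h => ?_
      exact Finset.disjoint_left.2 fun k hk hk' => h k hk (Finset.mem_filter.1 hk').2
    · intro V hV W hW _ _ _
      have hVi := fun k hk => Finset.mem_filter.1 (@hV k hk)
      have hWi := fun k hk => (hsd k).1 (@hW k hk)
      constructor
      · rintro ⟨a, ha, b, hb, c, hc, -, -, hab, hbc, -⟩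
        have h1 := hmono a (hVi a ha).1 b (hWi b hb).1 hab.le
        have h2 := hmono b (hWi b hb).1 c (hVi c hc).1 hbc.le
        rw [(hVi a ha).2] at h1
        rw [(hVi c hc).2] at h2
        exact (hWi b hb).2 (le_antisymm h2 h1)
      · rintro ⟨-, -, a, ha, b, hb, c, hc, -, hab, hbc⟩
        have h1 := hmono a (hVi a ha).1 b (hWi b hb).1 hab.le
        have h2 := hmono b (hWi b hb).1 c (hVi c hc).1 hbc.le
        rw [(hVi a ha).2] at h1
        rw [(hVi c hc).2] at h2
        exact (hWi b hb).2 (le_antisymm h2 h1)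

/-- A non-crossing partition into blocks of constant shade has a maximal interval of constant shade
which is a union of blocks. -/
theorem IsNCPartition.exists_level {pos : N → ℕ} {ε : N → Shade} {K : Finset N} {ι : N → ℕ}
    {δ : ℕ → Shade} (hI : IsIntervalIndex pos ε K ι δ) (hpos : pos.Injective) (hK : K.Nonempty)
    {B : Finset (Finset N)} (hB : IsNCPartition pos K B)
    (hε : ∀ W ∈ B, ∀ a ∈ W, ∀ b ∈ W, ε a = ε b) :
    ∃ i ∈ K.image ι, ∀ W ∈ B, (∀ k ∈ W, ι k = i) ∨ ∀ k ∈ W, ι k ≠ i := by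
  -- If some block meets two levels, take such a pair `a`, `b` in one block at minimal distance; the
  -- level just after that of `a` is the one sought.
  by_cases hex : ∃ d a b, pos a + d = pos b ∧ ι a ≠ ι b ∧ ∃ W ∈ B, a ∈ W ∧ b ∈ W
  · classical
    obtain ⟨a, b, hab, hne, W, hW, ha, hb⟩ := Nat.find_spec hex
    have hmin : ∀ a' b', pos a' ≤ pos b' → pos b' < pos a' + Nat.find hex → ι a' ≠ ι b' →
        ∀ W' ∈ B, a' ∈ W' → b' ∈ W' → False := by
      intro a' b' h1 h2 h3 W' hW' ha' hb'
      exact Nat.find_min hex (m := pos b' - pos a') (by omega)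
        ⟨a', b', by omega, h3, W', hW', ha', hb'⟩
    have haK := hB.subset hW ha
    have hbK := hB.subset hW hb
    have hlt : ι a < ι b :=
      lt_of_le_of_ne (hI.mono a haK b hbK (by omega)) hne
    -- `a` and `b` have the same shade while adjacent levels have different ones, so a whole level
    -- fits strictly between them.
    have hlt' : ι a + 1 < ι b := by
      refine lt_of_le_of_ne hlt fun h => ?_
      have := hε W hW a ha b hb
      rw [hI.shade a haK, hI.shade b hbK, ← h] at this
      exact hI.alternating _ this.symm
    have between : ∀ c ∈ K, ι c = ι a + 1 → pos a < pos c ∧ pos c < pos b := by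
      intro c hc hic
      constructor
      · by_contra h
        have := hI.mono c hc a haK (by omega)
        omega
      · by_contra h
        have := hI.mono b hbK c hc (by omega)
        omega
    obtain ⟨c₀, hc₀, hic₀⟩ := hI.connected b hbK (ι a + 1) hlt'.le
    refine ⟨ι a + 1, Finset.mem_image.2 ⟨c₀, hc₀, hic₀⟩, fun W' hW' => ?_⟩
    by_contra! hcon
    obtain ⟨⟨d, hd, hid⟩, c, hc, hic⟩ := hcon
    obtain ⟨hac, hcb⟩ := between c (hB.subset hW' hc) hic
    have hnW : W' ≠ W := by
      rintro rfl
      exact hmin a c hac.le (by omega) (by omega) W' hW' ha hc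
    have hda : pos d ≠ pos a := fun h =>
      hnW (hB.eq_of_mem W' hW' W hW d hd (hpos h ▸ ha))
    have hdb : pos d ≠ pos b := fun h =>
      hnW (hB.eq_of_mem W' hW' W hW d hd (hpos h ▸ hb))
    -- If `d` lies outside the positions from `a` to `b`, then `W'` and `W` cross; if inside, `c`
    -- and `d` are a closer pair than `a` and `b`.
    rcases lt_or_gt_of_ne hda with h | h
    · exact hnW (hB.nonCrossing W' hW' W hW ⟨d, hd, a, ha, c, hc, b, hb, h, hac, hcb⟩)
    rcases lt_or_gt_of_ne hdb with h' | h'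
    · rcases le_total (pos c) (pos d) with h'' | h''
      · exact hmin c d h'' (by omega) (by omega) W' hW' hc hd
      · exact hmin d c h'' (by omega) (by omega) W' hW' hd hc
    · exact hnW (hB.nonCrossing W hW W' hW' ⟨a, ha, c, hc, b, hb, d, hd, hac, hcb, h'⟩).symm
  -- Now every block lies in a single level, and any occupied level will do.
  · push Not at hex
    have hsame : ∀ W ∈ B, ∀ a ∈ W, ∀ b ∈ W, ι a = ι b := by
      intro W hW a ha b hb
      by_contra hne
      rcases le_total (pos a) (pos b) with h | h
      · exact hex (pos b - pos a) a b (by omega) hne W hW ha hb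
      · exact hex (pos a - pos b) b a (by omega) (Ne.symm hne) W hW hb ha
    obtain ⟨k, hk⟩ := hK
    refine ⟨ι k, Finset.mem_image_of_mem _ hk, fun W hW => ?_⟩
    by_cases h : ∃ a ∈ W, ι a = ι k
    · obtain ⟨a, ha, hak⟩ := h
      exact Or.inl fun b hb => (hsame W hW b hb a ha).trans hak
    · push Not at h
      exact Or.inr h

/-- The cumulants of `m δ` on sets of nodes of shade `δ`; mixed cumulants vanish. -/
noncomputable def shadeWeight (pos : N → ℕ) (ε : N → Shade) (m : Shade → Finset N → ℂ)
    (V : Finset N) : ℂ :=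
  ∑ δ, if ∀ k ∈ V, ε k = δ then cumulant pos (m δ) V else 0

theorem exists_shade_of_shadeWeight_ne_zero {pos : N → ℕ} {ε : N → Shade}
    {m : Shade → Finset N → ℂ} {V : Finset N} (h : shadeWeight pos ε m V ≠ 0) :
    ∃ δ, ∀ k ∈ V, ε k = δ := by
  obtain ⟨δ, -, hδ⟩ := Finset.exists_ne_zero_of_sum_ne_zero h
  exact ⟨δ, (ite_ne_right_iff.1 hδ).1⟩

theorem ncSum_shadeWeight {pos : N → ℕ} {ε : N → Shade} (m : Shade → Finset N → ℂ)
    {V : Finset N} (hV : V.Nonempty) {δ : Shade} (hδ : ∀ k ∈ V, ε k = δ) :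
    ncSum pos (shadeWeight pos ε m) V = m δ V := by
  rw [← ncSum_cumulant pos (m δ) hV]
  refine ncSum_congr pos fun W hW hne => ?_
  obtain ⟨k, hk⟩ := hne
  rw [shadeWeight, Finset.sum_eq_single δ]
  · exact if_pos fun k hk => hδ k (hW hk)
  · intro η _ hη
    exact if_neg fun h => hη ((h k hk).symm.trans (hδ k (hW hk)))
  · simp

/-- After exchanging the sums, a partition `B` of non-zero weight carries the alternating sum over
the subsets of the set `S` of levels that are unions of blocks of `B`, which is zero because `S` is
non-empty. -/
theorem altSum_ncSum {pos : N → ℕ} {ε : N → Shade} {K : Finset N} {ι : N → ℕ}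
    {δ : ℕ → Shade} (hI : IsIntervalIndex pos ε K ι δ) (hpos : pos.Injective) (hK : K.Nonempty)
    (m : Shade → Finset N → ℂ) :
    altSum ι (fun i => m (δ i)) (ncSum pos (shadeWeight pos ε m)) (K.image ι) K = 0 := by
  set g := shadeWeight pos ε m with hg
  have step : ∀ F ∈ (K.image ι).powerset,
      ((-1) ^ F.card * ∏ i ∈ F, m (δ i) (K.filter (ι · = i))) • ncSum pos g (K.filter (ι · ∉ F)) =
      ∑ B ∈ ncParts pos K, (if ∀ W ∈ B, ∀ i ∈ F, (∀ k ∈ W, ι k = i) ∨ ∀ k ∈ W, ι k ≠ i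
        then (-1) ^ F.card else 0) * ∏ W ∈ B, g W := by
    intro F hF
    have e : ∏ i ∈ F, m (δ i) (K.filter (ι · = i)) = ∏ i ∈ F, ncSum pos g (K.filter (ι · = i)) := by
      refine Finset.prod_congr rfl fun i hi => ?_
      obtain ⟨k, hk, rfl⟩ := Finset.mem_image.1 (Finset.mem_powerset.1 hF hi)
      have hne : (K.filter (ι · = ι k)).Nonempty := ⟨k, Finset.mem_filter.2 ⟨hk, rfl⟩⟩
      refine (ncSum_shadeWeight m hne fun a ha => ?_).symm
      obtain ⟨ha, hak⟩ := Finset.mem_filter.1 ha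
      rw [hI.shade a ha, hak]
    rw [e, smul_eq_mul, mul_assoc, ← ncSum_split_levels g F hI.mono, ncSum, Finset.mul_sum]
    refine Finset.sum_congr rfl fun B _ => ?_
    rw [Finset.prod_ite_zero]
    split_ifs <;> simp
  rw [altSum, Finset.sum_congr rfl step, Finset.sum_comm]
  refine Finset.sum_eq_zero fun B hB => ?_
  rw [mem_ncParts] at hB
  rw [← Finset.sum_mul]
  by_cases h0 : ∏ W ∈ B, g W = 0
  · rw [h0, mul_zero]
  have hε : ∀ W ∈ B, ∀ a ∈ W, ∀ b ∈ W, ε a = ε b := by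
    intro W hW a ha b hb
    obtain ⟨δ, hδ⟩ := exists_shade_of_shadeWeight_ne_zero (Finset.prod_ne_zero_iff.1 h0 W hW)
    rw [hδ a ha, hδ b hb]
  obtain ⟨i, hi, hsplit⟩ := hB.exists_level hI hpos hK hε
  set S := (K.image ι).filter fun i => ∀ W ∈ B, (∀ k ∈ W, ι k = i) ∨ ∀ k ∈ W, ι k ≠ i with hS
  have : ∀ F, (F ∈ (K.image ι).powerset ∧
      ∀ W ∈ B, ∀ i ∈ F, (∀ k ∈ W, ι k = i) ∨ ∀ k ∈ W, ι k ≠ i) ↔ F ∈ S.powerset := by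
    intro F
    simp only [Finset.mem_powerset, hS, Finset.subset_iff, Finset.mem_filter]
    constructor
    · exact fun h j hj => ⟨h.1 hj, fun W hW => h.2 W hW j hj⟩
    · exact fun h => ⟨fun j hj => (h hj).1, fun W hW j hj => (h hj).2 W hW⟩
  rw [← Finset.sum_filter, show Finset.filter _ _ = S.powerset from
    Finset.ext fun F => by rw [Finset.mem_filter, this F]]
  have h := Finset.sum_powerset_neg_one_pow_card_of_nonempty (x := S)
    ⟨i, Finset.mem_filter.2 ⟨hi, hsplit⟩⟩
  have h' := congrArg (Int.cast : ℤ → ℂ) h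
  push_cast at h'
  rw [h', zero_mul]

end Intervals

/-! ### Products of left and right operators on the free product -/

section Operators

open FreeProd

variable {X : Shade → StateVectorSpace.{x}}

theorem StateVectorSpace.coe_center (Y : StateVectorSpace.{x}) (y : Y) :
    (Y.center y : Y) = y - Y.state y • Y.vec := rfl

theorem embed_vec (δ : Shade) : embed δ (X δ).vec = (1 : Full X) := by
  have : (X δ).center (X δ).vec = 0 := by
    apply Subtype.ext
    simp [StateVectorSpace.coe_center, (X δ).state_vec]
  simp [embed, this, (X δ).state_vec]

theorem algebraMapInv_letter (δ : Shade) (y : (X δ).kernel) :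
    TensorAlgebra.algebraMapInv (letter δ y : Full X) = 0 := by
  simp [letter, TensorAlgebra.algebraMapInv]

theorem algebraMapInv_embed (δ : Shade) (y : X δ) :
    TensorAlgebra.algebraMapInv (embed δ y : Full X) = (X δ).state y := by
  simp [embed, algebraMapInv_letter]

/-- `T` sees only the factor `y`, even if `y` has a state-vector component: the tail is a scalar
plus a tensor starting with the other shade, so the action on the tail alone puts `T ξ` in front of
it. -/
theorem leftAct_embed_mul (δ : Shade) (T : Module.End ℂ (X δ)) (y : X δ) (c : ℂ)
    (x : (X δ.other).kernel) (w : Full X) :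
    leftAct δ T (embed δ y * (c • 1 + letter δ.other x * w)) =
      embed δ (T y) * (c • 1 + letter δ.other x * w) := by
  have hy : T y = (X δ).state y • T (X δ).vec + T ((X δ).center y) := by
    rw [← map_smul, ← map_add]
    simp [StateVectorSpace.coe_center]
  have e : embed δ y * (c • 1 + letter δ.other x * w) =
      (X δ).state y • (c • 1 + letter δ.other x * w) +
        letter δ ((X δ).center y) * (c • 1 + letter δ.other x * w) := by
    simp [embed, add_mul]
  rw [e, map_add, map_smul, map_add, map_smul, leftAct_one, leftAct_other, leftAct_same, hy,
    map_add, map_smul, add_mul, smul_mul_assoc, mul_add (embed δ (T (X δ).vec)), mul_smul_comm,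
    mul_one]

theorem rightAct_mul_embed (δ : Shade) (T : Module.End ℂ (X δ)) (y : X δ) (c : ℂ)
    (x : (X δ.other).kernel) (w : Full X) :
    rightAct δ T ((c • 1 + w * letter δ.other x) * embed δ y) =
      (c • 1 + w * letter δ.other x) * embed δ (T y) := by
  have hy : T y = (X δ).state y • T (X δ).vec + T ((X δ).center y) := by
    rw [← map_smul, ← map_add]
    simp [StateVectorSpace.coe_center]
  have e : (c • 1 + w * letter δ.other x) * embed δ y =
      (X δ).state y • (c • 1 + w * letter δ.other x) +
        (c • 1 + w * letter δ.other x) * letter δ ((X δ).center y) := by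
    simp [embed, mul_add]
  rw [e, map_add, map_smul, map_add, map_smul, rightAct_one, rightAct_other, rightAct_same, hy,
    map_add, map_smul, mul_add, mul_smul_comm, add_mul _ _ (embed δ (T (X δ).vec)),
    smul_mul_assoc, one_mul]

theorem leftAct_embed (δ : Shade) (T : Module.End ℂ (X δ)) (y : X δ) :
    leftAct δ T (embed δ y) = (embed δ (T y) : Full X) := by
  simpa using leftAct_embed_mul δ T y 1 0 (0 : Full X)

theorem rightAct_embed (δ : Shade) (T : Module.End ℂ (X δ)) (y : X δ) :
    rightAct δ T (embed δ y) = (embed δ (T y) : Full X) := by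
  simpa using rightAct_mul_embed δ T y 1 0 (0 : Full X)

theorem Finset.sort_insert_of_lt {N : Type*} [LinearOrder N] {t : N} {K : Finset N}
    (h : ∀ k ∈ K, t < k) : (insert t K).sort (· ≤ ·) = t :: K.sort (· ≤ ·) :=
  Finset.sort_insert _ (fun k hk => (h k hk).le) fun ht => (h t ht).false

/-! ### Vectors and moments of sets of nodes -/

variable {N : Type*} [LinearOrder N] (left : N → Prop) [DecidablePred left]
  (T : N → (δ : Shade) → Module.End ℂ (X δ)) (ε : N → Shade)

/-- The operator of the node `k`, of shade `ε k`, on tensor words. -/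
noncomputable def nodeAct (k : N) : Module.End ℂ (Full X) :=
  if left k then leftAct (ε k) (T k (ε k)) else rightAct (ε k) (T k (ε k))

/-- The product of the operators of the nodes in `K`, applied to the empty word. -/
noncomputable def wordVec (K : Finset N) : Full X :=
  ((K.sort (· ≤ ·)).map (nodeAct left T ε)).prod 1

/-- The product of the operators of the nodes in `K` on `X^δ`, applied to the state-vector. -/
noncomputable def faceVec (δ : Shade) (K : Finset N) : X δ :=
  ((K.sort (· ≤ ·)).map (T · δ)).prod (X δ).vec

/-- The moment on `X^δ` of the nodes in `K`. -/
noncomputable def faceMoment (δ : Shade) (K : Finset N) : ℂ := (X δ).state (faceVec T δ K)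

theorem wordVec_empty : wordVec left T ε ∅ = 1 := by simp [wordVec]

theorem faceVec_empty (δ : Shade) : faceVec T δ ∅ = (X δ).vec := by simp [faceVec]

theorem wordVec_insert {t : N} {K : Finset N} (h : ∀ k ∈ K, t < k) :
    wordVec left T ε (insert t K) = nodeAct left T ε t (wordVec left T ε K) := by
  simp [wordVec, Finset.sort_insert_of_lt h]

theorem faceVec_insert (δ : Shade) {t : N} {K : Finset N} (h : ∀ k ∈ K, t < k) :
    faceVec T δ (insert t K) = T t δ (faceVec T δ K) := by
  simp [faceVec, Finset.sort_insert_of_lt h]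

/-- On the copy of `X δ` in the tensor algebra, the left and the right action both reduce to `T`.
This identifies the moments of a single shade. -/
theorem wordVec_of_const {δ : Shade} (hε : ∀ k, ε k = δ) (K : Finset N) :
    wordVec left T ε K = embed δ (faceVec T δ K) := by
  unfold wordVec faceVec
  induction K.sort (· ≤ ·) with
  | nil => simp [embed_vec]
  | cons t l ih =>
    simp only [List.map_cons, List.prod_cons, Module.End.mul_apply, ih]
    unfold nodeAct
    rw [hε t]
    split_ifs
    · exact leftAct_embed ..
    · exact rightAct_embed ..

/-- The vector of the `i`-th interval of `K`, made orthogonal to the state-vector if `i ∈ C`. -/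
noncomputable def factorVec (ι : N → ℕ) (δ : ℕ → Shade) (C : Finset ℕ) (K : Finset N) (i : ℕ) :
    X (δ i) :=
  faceVec T (δ i) (K.filter (ι · = i)) -
    if i ∈ C then faceMoment T (δ i) (K.filter (ι · = i)) • (X (δ i)).vec else 0

theorem state_factorVec {ι : N → ℕ} {δ : ℕ → Shade} {C : Finset ℕ} {K : Finset N} {i : ℕ}
    (hi : i ∈ C) : (X (δ i)).state (factorVec T ι δ C K i) = 0 := by
  simp [factorVec, hi, faceMoment, (X (δ i)).state_vec]

theorem embed_factorVec_of_empty {ι : N → ℕ} {δ : ℕ → Shade} {C : Finset ℕ} {K : Finset N} {i : ℕ}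
    (hi : i ∉ C) (hK : ∀ k ∈ K, ι k ≠ i) :
    embed (δ i) (factorVec T ι δ C K i) = (1 : Full X) := by
  rw [factorVec, if_neg hi, sub_zero, Finset.filter_false_of_mem hK, faceVec_empty, embed_vec]

/-- The hypotheses of `altSum_wordVec` on the levels `C`. -/
structure IsAdmissible (ι : N → ℕ) (C : Finset ℕ) (K : Finset N) : Prop where
  subset : C ⊆ K.image ι
  between : ∀ a ∈ K, ∀ b ∈ K, ∀ i, ι a < i → i < ι b → i ∈ C

theorem List.prod_map_range_split {M : Type*} [Monoid M] (f : ℕ → M) {p m : ℕ} (h : p < m) :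
    ((List.range m).map f).prod = ((List.range p).map f).prod *
      (f p * ((List.range (m - p - 1)).map fun j => f (p + 1 + j)).prod) := by
  obtain ⟨q, rfl⟩ := Nat.exists_eq_add_of_lt h
  rw [show p + q + 1 = p + (1 + q) by ring, List.range_add, List.map_append, List.prod_append,
    List.range_add]
  simp [Function.comp_def, add_assoc]

theorem List.prod_map_eq_one {M : Type*} [Monoid M] {l : List ℕ} {f : ℕ → M}
    (h : ∀ i ∈ l, f i = 1) : (l.map f).prod = 1 :=
  List.prod_eq_one fun x hx => by
    obtain ⟨i, hi, rfl⟩ := List.mem_map.1 hx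
    exact h i hi

/-- A node whose level is never deleted occurs in every term, and as the least node it is the last
operator applied, so it factors out. -/
theorem altSum_insert_node {ι : N → ℕ} {C : Finset ℕ} (c : ℕ → Finset N → ℂ) {t : N}
    {K : Finset N} (ht : ∀ k ∈ K, t < k) (hC : ι t ∉ C) :
    altSum ι c (wordVec left T ε) C (insert t K) =
      nodeAct left T ε t (altSum ι c (wordVec left T ε) C K) := by
  unfold altSum
  rw [map_sum]
  refine Finset.sum_congr rfl fun F hF => ?_
  have htF : ι t ∉ F := fun h => hC (Finset.mem_powerset.1 hF h)
  rw [map_smul, Finset.filter_insert, if_pos htF,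
    wordVec_insert left T ε fun k hk => ht k (Finset.filter_subset _ _ hk)]
  congr 2
  refine Finset.prod_congr rfl fun i hi => ?_
  rw [Finset.filter_insert, if_neg fun h => htF (by rwa [h])]

/-- The product of the vectors of the intervals of `K`. -/
noncomputable def intervalProd (ι : N → ℕ) (δ : ℕ → Shade) (m : ℕ) (C : Finset ℕ) (K : Finset N) :
    Full X :=
  ((List.range m).map fun i => embed (δ i) (factorVec T ι δ C K i)).prod

/-- Expand the centred factor at `p` as the uncentred one minus its moment times 1; a factor 1 is
also what an emptied level contributes. This matches the recursion `altSum_insert`. -/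
theorem intervalProd_insert {ι : N → ℕ} (δ : ℕ → Shade) {m p : ℕ} {C : Finset ℕ} (K : Finset N)
    (hp : p ∉ C) (hm : p < m) :
    intervalProd T ι δ m (insert p C) K = intervalProd T ι δ m C K -
      faceMoment T (δ p) (K.filter (ι · = p)) •
        intervalProd T ι δ m C (K.filter (ι · ≠ p)) := by
  have h1 : ∀ i, i ≠ p → factorVec T ι δ (insert p C) K i = factorVec T ι δ C K i := by
    intro i hi
    simp [factorVec, hi]
  have h2 : ∀ i, i ≠ p → factorVec T ι δ C (K.filter (ι · ≠ p)) i = factorVec T ι δ C K i := by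
    intro i hi
    have : (K.filter (ι · ≠ p)).filter (ι · = i) = K.filter (ι · = i) := by
      ext k
      simp only [Finset.mem_filter]
      constructor
      · exact fun h => ⟨h.1.1, h.2⟩
      · exact fun h => ⟨⟨h.1, h.2 ▸ hi⟩, h.2⟩
    simp only [factorVec, this]
  have h3 : embed (δ p) (factorVec T ι δ C (K.filter (ι · ≠ p)) p) = (1 : Full X) :=
    embed_factorVec_of_empty T hp fun k hk => (Finset.mem_filter.1 hk).2
  have h4 : embed (δ p) (factorVec T ι δ (insert p C) K p) =
      embed (δ p) (factorVec T ι δ C K p) -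
        faceMoment T (δ p) (K.filter (ι · = p)) • (1 : Full X) := by
    simp [factorVec, hp, embed_vec]
  unfold intervalProd
  simp only [List.prod_map_range_split _ hm]
  have e1 : ∀ C' K', (∀ i, i ≠ p → factorVec T ι δ C' K' i = factorVec T ι δ C K i) →
      ((List.range p).map fun i => embed (δ i) (factorVec T ι δ C' K' i) : List (Full X)) =
      (List.range p).map fun i => embed (δ i) (factorVec T ι δ C K i) := by
    intro C' K' h
    refine List.map_congr_left fun i hi => ?_
    rw [h i (List.mem_range.1 hi).ne]
  have e2 : ∀ C' K', (∀ i, i ≠ p → factorVec T ι δ C' K' i = factorVec T ι δ C K i) →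
      ((List.range (m - p - 1)).map fun j =>
        embed (δ (p + 1 + j)) (factorVec T ι δ C' K' (p + 1 + j)) : List (Full X)) =
      (List.range (m - p - 1)).map fun j =>
        embed (δ (p + 1 + j)) (factorVec T ι δ C K (p + 1 + j)) := by
    intro C' K' h
    refine List.map_congr_left fun i hi => ?_
    rw [h _ (by omega)]
  rw [e1 _ _ h1, e1 _ _ h2, e2 _ _ h1, e2 _ _ h2, h3, h4]
  simp [sub_mul, mul_sub]

theorem exists_embed_eq {δ η : Shade} (h : η ≠ δ) (y : X η) :
    ∃ (c : ℂ) (x : (X δ.other).kernel), embed η y = (c • 1 + letter δ.other x : Full X) ∧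
      ((X η).state y = 0 → c = 0) := by
  obtain rfl := (shade_cases δ η).resolve_left h
  exact ⟨(X δ.other).state y, (X δ.other).center y, by simp [embed], id⟩

theorem factorVec_insert_self {ι : N → ℕ} (δ : ℕ → Shade) {C : Finset ℕ} {K : Finset N} {t : N}
    (ht : ∀ k ∈ K, t < k) (hC : ι t ∉ C) :
    factorVec T ι δ C (insert t K) (ι t) = T t (δ (ι t)) (factorVec T ι δ C K (ι t)) := by
  rw [factorVec, factorVec, if_neg hC, sub_zero, if_neg hC, sub_zero, Finset.filter_insert,
    if_pos rfl, faceVec_insert T _ fun k hk => ht k (Finset.filter_subset _ _ hk)]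

theorem factorVec_insert_of_ne {ι : N → ℕ} (δ : ℕ → Shade) (C : Finset ℕ) (K : Finset N) {t : N}
    {i : ℕ} (hi : i ≠ ι t) : factorVec T ι δ C (insert t K) i = factorVec T ι δ C K i := by
  simp only [factorVec, Finset.filter_insert, if_neg hi.symm]

/-- All factors before the level of `t` are 1, so the operator reaches the factor of that level,
provided the tail has the shape required by `leftAct_embed_mul`. -/
theorem leftAct_intervalProd {ι : N → ℕ} {δ : ℕ → Shade} (hδ : ∀ i, δ (i + 1) ≠ δ i) {m : ℕ}
    {C : Finset ℕ} {K : Finset N} {t : N} (ht : ∀ k ∈ K, t < k) (hm : ι t < m) (hC : ι t ∉ C)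
    (hK : ∀ k ∈ K, ι t ≤ ι k) (hadm : IsAdmissible ι C K)
    (hbet : ∀ b ∈ K, ∀ i, ι t < i → i < ι b → i ∈ C) :
    leftAct (δ (ι t)) (T t (δ (ι t))) (intervalProd T ι δ m C K) =
      intervalProd T ι δ m C (insert t K) := by
  set p := ι t with hp
  unfold intervalProd
  have hpre : ∀ i < p, embed (δ i) (factorVec T ι δ C K i) = (1 : Full X) := by
    intro i hi
    refine embed_factorVec_of_empty T (fun h => ?_) fun k hk h => ?_
    · obtain ⟨k, hk, rfl⟩ := Finset.mem_image.1 (hadm.subset h)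
      exact (hK k hk).not_gt hi
    · exact (hK k hk).not_gt (h ▸ hi)
  have hsuf : ∃ (c : ℂ) (x : (X (δ p).other).kernel) (w : Full X),
      ((List.range (m - p - 1)).map fun j =>
        embed (δ (p + 1 + j)) (factorVec T ι δ C K (p + 1 + j))).prod =
      c • 1 + letter (δ p).other x * w := by
    rcases m - p - 1 with _ | q
    · exact ⟨1, 0, 0, by simp⟩
    rw [List.range_succ_eq_map, List.map_cons, List.prod_cons]
    obtain ⟨c, x, hcx, hc⟩ := exists_embed_eq (hδ p) (factorVec T ι δ C K (p + 1))
    rw [add_zero, hcx]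
    -- If the factor at `p + 1` is centred, the tail starts with a genuine letter of the other
    -- shade. If not, `hbet` leaves no nodes beyond that level, and the tail is this one factor.
    by_cases h : p + 1 ∈ C
    · rw [hc (state_factorVec T h), zero_smul, zero_add]
      exact ⟨0, x, _, by rw [zero_smul, zero_add]⟩
    · have hno : ∀ k ∈ K, ι k ≤ p + 1 := fun k hk => by
        by_contra hk'
        exact h (hbet k hk (p + 1) (by omega) (by omega))
      refine ⟨c, x, 1, ?_⟩
      rw [List.prod_eq_one, mul_one, mul_one]
      simp only [List.map_map, List.mem_map, Function.comp_apply]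
      rintro _ ⟨j, -, rfl⟩
      refine embed_factorVec_of_empty T (fun h' => ?_) fun k hk h' => ?_
      · obtain ⟨k, hk, hkj⟩ := Finset.mem_image.1 (hadm.subset h')
        have := hno k hk
        omega
      · have := hno k hk
        omega
  obtain ⟨c, x, w, hw⟩ := hsuf
  rw [List.prod_map_range_split _ hm, List.prod_map_range_split _ hm]
  have e1 : ((List.range p).map fun i => embed (δ i) (factorVec T ι δ C (insert t K) i)) =
      ((List.range p).map fun i => embed (δ i) (factorVec T ι δ C K i) : List (Full X)) :=
    List.map_congr_left fun i hi => by
      rw [factorVec_insert_of_ne T δ C K (List.mem_range.1 hi).ne]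
  have e2 : ((List.range (m - p - 1)).map fun j =>
        embed (δ (p + 1 + j)) (factorVec T ι δ C (insert t K) (p + 1 + j))) =
      ((List.range (m - p - 1)).map fun j =>
        embed (δ (p + 1 + j)) (factorVec T ι δ C K (p + 1 + j)) : List (Full X)) :=
    List.map_congr_left fun i hi => by
      rw [factorVec_insert_of_ne T δ C K (by omega)]
  have hself : factorVec T ι δ C (insert t K) p = T t (δ p) (factorVec T ι δ C K p) :=
    factorVec_insert_self T δ ht hC
  rw [e1, e2, hw, List.prod_map_eq_one fun i hi => hpre i (List.mem_range.1 hi), one_mul, one_mul,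
    leftAct_embed_mul, hself]

/-- Mirror image of `leftAct_intervalProd`: the factors after the level of `t` are 1 and the
preceding factor decides the shape. -/
theorem rightAct_intervalProd {ι : N → ℕ} {δ : ℕ → Shade} (hδ : ∀ i, δ (i + 1) ≠ δ i) {m : ℕ}
    {C : Finset ℕ} {K : Finset N} {t : N} (ht : ∀ k ∈ K, t < k) (hm : ι t < m) (hC : ι t ∉ C)
    (hK : ∀ k ∈ K, ι k ≤ ι t) (hadm : IsAdmissible ι C K)
    (hbet : ∀ a ∈ K, ∀ i, ι a < i → i < ι t → i ∈ C) :
    rightAct (δ (ι t)) (T t (δ (ι t))) (intervalProd T ι δ m C K) =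
      intervalProd T ι δ m C (insert t K) := by
  set p := ι t with hp
  unfold intervalProd
  have hsuf : ∀ j, embed (δ (p + 1 + j)) (factorVec T ι δ C K (p + 1 + j)) = (1 : Full X) := by
    intro j
    refine embed_factorVec_of_empty T (fun h => ?_) fun k hk h => ?_
    · obtain ⟨k, hk, hkj⟩ := Finset.mem_image.1 (hadm.subset h)
      have := hK k hk
      omega
    · have := hK k hk
      omega
  have hpre : ∃ (c : ℂ) (x : (X (δ p).other).kernel) (w : Full X),
      ((List.range p).map fun i => embed (δ i) (factorVec T ι δ C K i)).prod =
      c • 1 + w * letter (δ p).other x := by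
    rcases p with _ | q
    · exact ⟨1, 0, 0, by simp⟩
    rw [List.range_succ, List.map_append, List.prod_append, List.map_singleton,
      List.prod_singleton]
    obtain ⟨c, x, hcx, hc⟩ := exists_embed_eq (hδ q).symm (factorVec T ι δ C K q)
    rw [hcx]
    by_cases h : q ∈ C
    · rw [hc (state_factorVec T h), zero_smul, zero_add]
      exact ⟨0, x, _, by rw [zero_smul, zero_add]⟩
    · have hno : ∀ k ∈ K, q ≤ ι k := fun k hk => by
        by_contra hk'
        exact h (hbet k hk q (by omega) (by omega))
      refine ⟨c, x, 1, ?_⟩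
      rw [List.prod_map_eq_one, one_mul, one_mul]
      intro j hj
      have hj := List.mem_range.1 hj
      refine embed_factorVec_of_empty T (fun h' => ?_) fun k hk h' => ?_
      · obtain ⟨k, hk, hkj⟩ := Finset.mem_image.1 (hadm.subset h')
        have := hno k hk
        omega
      · have := hno k hk
        omega
  obtain ⟨c, x, w, hw⟩ := hpre
  rw [List.prod_map_range_split _ hm, List.prod_map_range_split _ hm]
  have e1 : ((List.range p).map fun i => embed (δ i) (factorVec T ι δ C (insert t K) i)) =
      ((List.range p).map fun i => embed (δ i) (factorVec T ι δ C K i) : List (Full X)) :=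
    List.map_congr_left fun i hi => by
      rw [factorVec_insert_of_ne T δ C K (List.mem_range.1 hi).ne]
  have e2 : ((List.range (m - p - 1)).map fun j =>
        embed (δ (p + 1 + j)) (factorVec T ι δ C (insert t K) (p + 1 + j))) =
      ((List.range (m - p - 1)).map fun j =>
        embed (δ (p + 1 + j)) (factorVec T ι δ C K (p + 1 + j)) : List (Full X)) :=
    List.map_congr_left fun i hi => by
      rw [factorVec_insert_of_ne T δ C K (by omega)]
  have hself : factorVec T ι δ C (insert t K) p = T t (δ p) (factorVec T ι δ C K p) :=
    factorVec_insert_self T δ ht hC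
  rw [e1, e2, hw, List.prod_map_eq_one fun i _ => hsuf i, mul_one, mul_one,
    rightAct_mul_embed, hself]

/-- Induction on `K` through its least node `t`, the outermost operator. A general `C` is needed
because the level of `t` must stay uncentred while `t` acts on it, and is centred only afterwards.
-/
theorem altSum_wordVec {ι : N → ℕ} {δ : ℕ → Shade} (hδ : ∀ i, δ (i + 1) ≠ δ i) {m : ℕ}
    {C : Finset ℕ} {K : Finset N} (hε : ∀ k ∈ K, ε k = δ (ι k)) (hm : ∀ k ∈ K, ι k < m)
    (hL : ∀ t ∈ K, ∀ k ∈ K, t ≤ k → left t → ι t ≤ ι k)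
    (hR : ∀ t ∈ K, ∀ k ∈ K, t ≤ k → ¬ left t → ι k ≤ ι t) (hadm : IsAdmissible ι C K) :
    altSum ι (fun i => faceMoment T (δ i)) (wordVec left T ε) C K =
      intervalProd T ι δ m C K := by
  induction K using Finset.strongInduction generalizing C with
  | H K ih =>
    rcases K.eq_empty_or_nonempty with rfl | hK
    · have hC : C = ∅ := Finset.subset_empty.1 (by simpa using hadm.subset)
      subst hC
      rw [intervalProd, List.prod_map_eq_one fun i _ =>
        embed_factorVec_of_empty T (Finset.notMem_empty i) (by simp)]
      simp [altSum, wordVec_empty]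
    have sub : ∀ K' ⊂ K, ∀ C', IsAdmissible ι C' K' →
        altSum ι (fun i => faceMoment T (δ i)) (wordVec left T ε) C' K' =
          intervalProd T ι δ m C' K' := fun K' h C' hadm' =>
      ih K' h (fun k hk => hε k (h.1 hk)) (fun k hk => hm k (h.1 hk))
        (fun t ht k hk => hL t (h.1 ht) k (h.1 hk)) (fun t ht k hk => hR t (h.1 ht) k (h.1 hk))
        hadm'
    set t := K.min' hK with ht
    have htK : t ∈ K := K.min'_mem hK
    have hle : ∀ k ∈ K, t ≤ k := fun k hk => K.min'_le k hk
    -- The level of `t` is the lowest if `t` is left and the highest if `t` is right, so erasing it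
    -- from `C` preserves admissibility.
    have hout : ∀ a ∈ K, ∀ b ∈ K, ¬ (ι a < ι t ∧ ι t < ι b) := by
      rintro a ha b hb ⟨h1, h2⟩
      by_cases hl : left t
      · exact (hL t htK a ha (hle a ha) hl).not_gt h1
      · exact (hR t htK b hb (hle b hb) hl).not_gt h2
    have key : altSum ι (fun i => faceMoment T (δ i)) (wordVec left T ε) (C.erase (ι t)) K =
        intervalProd T ι δ m (C.erase (ι t)) K := by
      have hins : insert t (K.erase t) = K := Finset.insert_erase htK
      have hlt : ∀ k ∈ K.erase t, t < k := fun k hk =>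
        lt_of_le_of_ne (hle k (Finset.mem_of_mem_erase hk)) (Finset.ne_of_mem_erase hk).symm
      have hnot : ι t ∉ C.erase (ι t) := Finset.notMem_erase _ _
      have hbet : ∀ a ∈ K, ∀ b ∈ K, ∀ i, ι a < i → i < ι b → i ∈ C.erase (ι t) := by
        intro a ha b hb i h1 h2
        refine Finset.mem_erase.2 ⟨?_, hadm.between a ha b hb i h1 h2⟩
        rintro rfl
        exact hout a ha b hb ⟨h1, h2⟩
      have hadm' : IsAdmissible ι (C.erase (ι t)) (K.erase t) := by
        constructor
        · intro i hi
          obtain ⟨hit, hi⟩ := Finset.mem_erase.1 hi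
          obtain ⟨k, hk, rfl⟩ := Finset.mem_image.1 (hadm.subset hi)
          exact Finset.mem_image_of_mem _ (Finset.mem_erase.2 ⟨fun h => hit (by rw [h]), hk⟩)
        · exact fun a ha b hb => hbet a (Finset.mem_of_mem_erase ha) b (Finset.mem_of_mem_erase hb)
      have e := altSum_insert_node left T ε (fun i => faceMoment T (δ i)) hlt hnot
      rw [sub _ (Finset.erase_ssubset htK) _ hadm', hins, nodeAct, hε t htK] at e
      rw [e]
      split_ifs with hl
      · rw [leftAct_intervalProd T hδ hlt (hm t htK) hnot
          (fun k hk => hL t htK k (Finset.mem_of_mem_erase hk) (hlt k hk).le hl) hadm'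
          (fun b hb => hbet t htK b (Finset.mem_of_mem_erase hb)), hins]
      · rw [rightAct_intervalProd T hδ hlt (hm t htK) hnot
          (fun k hk => hR t htK k (Finset.mem_of_mem_erase hk) (hlt k hk).le hl) hadm'
          (fun a ha => hbet a (Finset.mem_of_mem_erase ha) t htK), hins]
    -- If the level of `t` is to be centred, both sides are expanded at that level; `key` and the
    -- induction hypothesis cover the two resulting terms.
    by_cases hC : ι t ∈ C
    · have hnot : ι t ∉ C.erase (ι t) := Finset.notMem_erase _ _
      have hss : K.filter (ι · ≠ ι t) ⊂ K := by
        rw [Finset.filter_ssubset]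
        exact ⟨t, htK, by simp⟩
      rw [← Finset.insert_erase hC, altSum_insert _ _ _ hnot,
        intervalProd_insert T δ K hnot (hm t htK), key, sub _ hss]
      constructor
      · intro i hi
        obtain ⟨hit, hi⟩ := Finset.mem_erase.1 hi
        obtain ⟨k, hk, rfl⟩ := Finset.mem_image.1 (hadm.subset hi)
        exact Finset.mem_image_of_mem _ (Finset.mem_filter.2 ⟨hk, hit⟩)
      · intro a ha b hb i h1 h2
        have ha := (Finset.mem_filter.1 ha).1
        have hb := (Finset.mem_filter.1 hb).1
        refine Finset.mem_erase.2 ⟨?_, hadm.between a ha b hb i h1 h2⟩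
        rintro rfl
        exact hout a ha b hb ⟨h1, h2⟩
    · rwa [Finset.erase_eq_of_notMem hC] at key

/-- The moment of the nodes in `K` in the free product. -/
noncomputable def wordMoment (K : Finset N) : ℂ :=
  TensorAlgebra.algebraMapInv (wordVec left T ε K)

theorem altSum_wordMoment {pos : N → ℕ} {ι : N → ℕ} {δ : ℕ → Shade} {K : Finset N}
    (hI : IsIntervalIndex pos ε K ι δ) (hK : K.Nonempty)
    (hL : ∀ t k, t ≤ k → left t → pos t ≤ pos k) (hR : ∀ t k, t ≤ k → ¬ left t → pos k ≤ pos t) :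
    altSum ι (fun i => faceMoment T (δ i)) (wordMoment left T ε) (K.image ι) K = 0 := by
  have hm : ∀ k ∈ K, ι k < K.sup ι + 1 := fun k hk => Nat.lt_succ_of_le (Finset.le_sup hk)
  have h := altSum_wordVec left T ε hI.alternating (C := K.image ι) hI.shade hm
    (fun t ht k hk htk hl => hI.mono t ht k hk (hL t k htk hl))
    (fun t ht k hk htk hl => hI.mono k hk t ht (hR t k htk hl))
    ⟨subset_rfl, fun a ha b hb i _ hi => Finset.mem_image.2 (hI.connected b hb i hi.le)⟩
  have h' := congrArg (TensorAlgebra.algebraMapInv (R := ℂ) (M := Letters X)).toLinearMap h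
  rw [map_altSum] at h'
  refine h'.trans ?_
  obtain ⟨k, hk⟩ := hK
  rw [AlgHom.toLinearMap_apply, intervalProd, map_list_prod, List.map_map]
  -- The projection to the empty word is multiplicative, so one centred factor is enough for the
  -- product to vanish.
  refine List.prod_eq_zero (List.mem_map.2 ⟨ι k, List.mem_range.2 (hm k hk), ?_⟩)
  rw [Function.comp_apply, algebraMapInv_embed, state_factorVec T (Finset.mem_image_of_mem _ hk)]

end Operators

/-! ### The moment-cumulant formula and Möbius inversion -/

section MomentFormula

theorem eq_of_altSum_eq {N : Type*} {ι : N → ℕ} {c : ℕ → Finset N → ℂ} {f g : Finset N → ℂ}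
    {K : Finset N} (h : ∀ K' ⊂ K, f K' = g K')
    (hfg : altSum ι c f (K.image ι) K = altSum ι c g (K.image ι) K) : f K = g K := by
  unfold altSum at hfg
  have h0 : ∅ ∈ (K.image ι).powerset := Finset.empty_mem_powerset _
  rw [← Finset.add_sum_erase _ _ h0, ← Finset.add_sum_erase _ _ h0] at hfg
  have : ∀ F ∈ (K.image ι).powerset.erase ∅,
      ((-1) ^ F.card * ∏ i ∈ F, c i (K.filter (ι · = i))) • f (K.filter (ι · ∉ F)) =
      ((-1) ^ F.card * ∏ i ∈ F, c i (K.filter (ι · = i))) • g (K.filter (ι · ∉ F)) := by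
    intro F hF
    obtain ⟨hne, hF⟩ := Finset.mem_erase.1 hF
    obtain ⟨i, hi⟩ := Finset.nonempty_iff_ne_empty.2 hne
    obtain ⟨k, hk, rfl⟩ := Finset.mem_image.1 (Finset.mem_powerset.1 hF hi)
    rw [h _ (Finset.filter_ssubset.2 ⟨k, hk, not_not.2 hi⟩)]
  rw [Finset.sum_congr rfl this] at hfg
  simpa only [Finset.card_empty, pow_zero, Finset.prod_empty, mul_one, one_smul,
    Finset.notMem_empty, not_false_eq_true, Finset.filter_true] using add_right_cancel hfg

open FreeProd in
theorem wordMoment_eq_ncSum {X : Shade → StateVectorSpace.{x}} {N : Type*} [LinearOrder N]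
    [Fintype N] (left : N → Prop) [DecidablePred left]
    (T : N → (δ : Shade) → Module.End ℂ (X δ)) (ε : N → Shade) {pos : N → ℕ}
    (hpos : pos.Injective) (hL : ∀ t k, t ≤ k → left t → pos t ≤ pos k)
    (hR : ∀ t k, t ≤ k → ¬ left t → pos k ≤ pos t) (K : Finset N) :
    wordMoment left T ε K = ncSum pos (shadeWeight pos ε (faceMoment T)) K := by
  induction K using Finset.strongInduction with
  | H K ih =>
    rcases K.eq_empty_or_nonempty with rfl | hK
    · simp [ncSum_empty, wordMoment, wordVec_empty]
    · obtain ⟨ι, δ, hI⟩ := exists_isIntervalIndex hpos ε K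
      refine eq_of_altSum_eq (ι := ι) (c := fun i => faceMoment T (δ i)) ih ?_
      rw [altSum_wordMoment left T ε hI hK hL hR, altSum_ncSum hI hpos hK]

/-- Möbius inversion on a down-closed set: once the sum over `a` is innermost, `μ(a, b)` summed over
`c ≤ a ≤ b` vanishes unless `c = b`. -/
theorem sum_mu_mul_sum {P : Type*} [Fintype P] [PartialOrder P] [LocallyFiniteOrder P]
    [DecidableEq P] [DecidableLE P] (p : P → Prop) [DecidablePred p]
    (hp : ∀ a b, a ≤ b → p b → p a) (k : P → ℂ) :
    ∑ a with p a, (∑ b with a ≤ b ∧ p b, IncidenceAlgebra.mu ℂ a b) * ∑ c with c ≤ a, k c =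
      ∑ c with p c, k c := by
  have h : ∀ c b, p b → ∑ a with c ≤ a ∧ a ≤ b, IncidenceAlgebra.mu ℂ a b =
      if c = b then 1 else 0 := by
    intro c b _
    rw [← IncidenceAlgebra.sum_Icc_mu_left (𝕜 := ℂ) c b]
    refine Finset.sum_congr (Finset.ext fun a => ?_) fun _ _ => rfl
    simp
  calc _ = ∑ a, ∑ b, ∑ c, if p b then
        (if c ≤ a ∧ a ≤ b then IncidenceAlgebra.mu ℂ a b else 0) * k c else 0 := by
        rw [Finset.sum_filter]
        refine Finset.sum_congr rfl fun a _ => ?_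
        split_ifs with ha
        · rw [Finset.sum_mul_sum, Finset.sum_filter]
          refine Finset.sum_congr rfl fun b _ => ?_
          rw [Finset.sum_filter]
          by_cases h1 : a ≤ b <;> by_cases h2 : p b <;> simp [h1, h2, ite_mul]
        -- Down-closedness is used here: an `a` outside the set lies below no `b` inside it.
        · refine (Finset.sum_eq_zero fun b _ => Finset.sum_eq_zero fun c _ => ?_).symm
          split_ifs with h1 h2
          · exact (ha (hp a b h2.2 h1)).elim
          · simp
          · rfl
    _ = ∑ c, ∑ b, if p b then
        (∑ a with c ≤ a ∧ a ≤ b, IncidenceAlgebra.mu ℂ a b) * k c else 0 := by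
        rw [Finset.sum_comm]
        simp_rw [Finset.sum_comm (s := Finset.univ (α := P)) (t := Finset.univ (α := P))
          (f := fun a c => if p _ then (if c ≤ a ∧ a ≤ _ then
            IncidenceAlgebra.mu ℂ a _ else 0) * k c else 0)]
        rw [Finset.sum_comm]
        refine Finset.sum_congr rfl fun c _ => Finset.sum_congr rfl fun b _ => ?_
        split_ifs
        · rw [Finset.sum_filter, Finset.sum_mul]
        · simp
    _ = _ := by
        rw [Finset.sum_filter]
        refine Finset.sum_congr rfl fun c _ => ?_
        rw [Finset.sum_eq_single c]
        · split_ifs with hc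
          · rw [h c c hc]
            simp
          · rfl
        · intro b _ hb
          split_ifs with hpb
          · rw [h c b hpb, if_neg hb.symm, zero_mul]
          · rfl
        · simp

/-! ### Bi-non-crossing partitions and evaluation of the polynomials -/

variable {I : Type u} {J : Type v} {n : ℕ} (α : Fin n → I ⊕ J)

/-- `sidePerm α` lists the nodes by increasing `sideKey`, so undoing it turns the order by key into
the usual order. -/
theorem isBiNonCrossing_iff (π : NodePartition n) :
    IsBiNonCrossing α π ↔ IsNCPartition (sideKey α) Finset.univ π.parts := by
  have hlt : ∀ a b, sideKey α (sidePerm α a) < sideKey α (sidePerm α b) ↔ a < b := fun a b =>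
    (sidePerm_strictMono α).lt_iff_lt
  have hmem : ∀ (V : Finset (Fin n)) a, a ∈ V.image (sidePerm α).symm ↔ sidePerm α a ∈ V := by
    intro V a
    simp [Finset.mem_image, Equiv.symm_apply_eq]
  have hinj : Function.Injective (Finset.image (sidePerm α).symm) :=
    Finset.image_injective (sidePerm α).symm.injective
  constructor
  · intro h
    refine ⟨fun W hW => π.nonempty_of_mem_parts hW,
      fun V hV W hW k hkV hkW => π.eq_of_mem_parts hV hW hkV hkW,
      fun k => ⟨fun hk => π.exists_mem hk, fun _ => Finset.mem_univ k⟩, ?_⟩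
    rintro V hV W hW ⟨a, ha, b, hb, c, hc, d, hd, hab, hbc, hcd⟩
    refine hinj (h _ (Finset.mem_image_of_mem _ hV) _ (Finset.mem_image_of_mem _ hW)
      ((sidePerm α).symm a) ((sidePerm α).symm b) ((sidePerm α).symm c) ((sidePerm α).symm d)
      ?_ ?_ ?_ ?_ ?_ ?_ ?_)
    all_goals first | rw [← hlt] | rw [hmem]
    all_goals simpa only [Equiv.apply_symm_apply]
  · intro h V' hV' W' hW' a b c d hab hbc hcd ha hc hb hd
    obtain ⟨V, hV, rfl⟩ := Finset.mem_image.1 hV'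
    obtain ⟨W, hW, rfl⟩ := Finset.mem_image.1 hW'
    rw [hmem] at ha hb hc hd
    rw [h.nonCrossing V hV W hW ⟨_, ha, _, hb, _, hc, _, hd, (hlt _ _).2 hab, (hlt _ _).2 hbc,
      (hlt _ _).2 hcd⟩]

theorem ncSum_univ (g : Finset (Fin n) → ℂ) :
    ncSum (sideKey α) g Finset.univ = ∑ τ : BNC α, ∏ W ∈ τ.1.parts, g W := by
  symm
  refine Finset.sum_bij (fun τ _ => τ.1.parts) ?_ ?_ ?_ ?_
  · intro τ _
    exact (mem_ncParts _).2 ((isBiNonCrossing_iff α τ.1).1 τ.2)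
  · intro τ _ τ' _ h
    exact Subtype.ext (Finpartition.ext h)
  · intro B hB
    rw [mem_ncParts] at hB
    have hu : ∀ a ∈ (Finset.univ : Finset (Fin n)), ∃! t, t ∈ B ∧ a ∈ t := by
      intro a ha
      obtain ⟨W, hW, haW⟩ := (hB.cover a).1 ha
      exact ⟨W, ⟨hW, haW⟩, fun V hV => hB.eq_of_mem V hV.1 W hW a hV.2 haW⟩
    let π : NodePartition n := Finpartition.ofExistsUnique B (fun _ _ => Finset.subset_univ _) hu
      fun h => (hB.nonempty ∅ h).ne_empty rfl
    exact ⟨⟨π, (isBiNonCrossing_iff α π).2 hB⟩, Finset.mem_univ _, rfl⟩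
  · intro τ _
    rfl

theorem le_shadePartition_iff {ε : Fin n → Shade} {π : NodePartition n} :
    π ≤ shadePartition ε ↔ ∀ V ∈ π.parts, ∃ δ, ∀ k ∈ V, ε k = δ := by
  let _ : DecidableRel (Setoid.ker ε).r := fun a b => inferInstanceAs (Decidable (ε a = ε b))
  have hpart : ∀ a b, b ∈ (shadePartition ε).part a ↔ ε a = ε b := by
    intro a b
    exact Finpartition.mem_part_ofSetoid_iff_rel
  constructor
  · intro h V hV
    obtain ⟨W, hW, hVW⟩ := h hV
    obtain ⟨a, ha⟩ := π.nonempty_of_mem_parts hV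
    refine ⟨ε a, fun k hk => ?_⟩
    rw [← (shadePartition ε).part_eq_of_mem hW (hVW ha)] at hVW
    exact ((hpart a k).1 (hVW hk)).symm
  · intro h V hV
    obtain ⟨δ, hδ⟩ := h V hV
    obtain ⟨a, ha⟩ := π.nonempty_of_mem_parts hV
    exact ⟨_, (shadePartition ε).part_mem.2 (Finset.mem_univ a), fun k hk =>
      (hpart a k).2 ((hδ a ha).trans (hδ k hk).symm)⟩

open Classical in
theorem eval_momentPoly (ε : Fin n → Shade) (m : Shade → Finset (Fin n) → ℂ) :
    MvPolynomial.eval (fun p : Indet n => m p.1 p.2.1) (momentPoly α ε) =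
      ncSum (sideKey α) (shadeWeight (sideKey α) ε m) Finset.univ := by
  set g := shadeWeight (sideKey α) ε m with hg
  have hprod : ∀ π : BNC α, π.1 ≤ shadePartition ε →
      ∏ V ∈ π.1.parts.attach, m (blockShade ε (blockSet π.1 V)) V.1 =
        ∑ τ : BNC α with τ ≤ π, ∏ W ∈ τ.1.parts, g W := by
    intro π hπ
    rw [le_shadePartition_iff] at hπ
    have h1 : ∏ V ∈ π.1.parts.attach, m (blockShade ε (blockSet π.1 V)) V.1 =
        ∏ V ∈ π.1.parts.attach, ncSum (sideKey α) g V.1 := by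
      refine Finset.prod_congr rfl fun V _ => ?_
      have hne := π.1.nonempty_of_mem_parts V.2
      obtain ⟨δ, hδ⟩ := hπ V.1 V.2
      have : blockShade ε (blockSet π.1 V) = δ := hδ _ (Finset.min'_mem _ hne)
      rw [this, hg, ncSum_shadeWeight m hne hδ]
    have hD := (isBiNonCrossing_iff α π.1).1 π.2
    rw [h1, Finset.prod_attach π.1.parts fun V => ncSum (sideKey α) g V]
    -- Suppressing the weights of sets that lie in no block of `π` makes `ncSum_eq_prod` applicable;
    -- the surviving partitions are those below `π`.
    have h2 : ∏ V ∈ π.1.parts, ncSum (sideKey α) g V = ∏ V ∈ π.1.parts,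
        ncSum (sideKey α) (fun W => if ∃ V ∈ π.1.parts, W ⊆ V then g W else 0) V := by
      refine Finset.prod_congr rfl fun V hV => ncSum_congr _ fun W hW _ => ?_
      rw [if_pos ⟨V, hV, hW⟩]
    rw [h2, ← ncSum_eq_prod _ hD, ncSum_univ, Finset.sum_filter]
    · refine Finset.sum_congr rfl fun τ _ => ?_
      rw [Finset.prod_ite_zero]
      by_cases hτ : τ ≤ π
      · rw [if_pos hτ, if_pos fun W hW => hτ hW]
      · rw [if_neg hτ, if_neg fun h => hτ fun W hW => h W hW]
    · intro W _ _ hW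
      exact (ite_ne_right_iff.1 hW).1
  calc _ = ∑ π : BNC α with π.1 ≤ shadePartition ε,
        (∑ σ : BNC α with π ≤ σ ∧ σ.1 ≤ shadePartition ε, IncidenceAlgebra.mu ℂ π σ) *
          ∑ τ : BNC α with τ ≤ π, ∏ W ∈ τ.1.parts, g W := by
        rw [momentPoly, map_sum]
        refine Finset.sum_congr rfl fun π hπ => ?_
        rw [map_mul, MvPolynomial.eval_C, map_prod, ← hprod π (Finset.mem_filter.1 hπ).2]
        simp only [MvPolynomial.eval_X]
        rfl
    _ = ∑ τ : BNC α with τ.1 ≤ shadePartition ε, ∏ W ∈ τ.1.parts, g W :=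
        sum_mu_mul_sum (fun π : BNC α => π.1 ≤ shadePartition ε) (fun a b hab hb => le_trans (Subtype.coe_le_coe.2 hab) hb) _
    _ = _ := by
        rw [ncSum_univ]
        -- A partition not below the shading has a block of two shades, whose weight is zero.
        refine Finset.sum_subset (Finset.filter_subset _ _) fun τ _ hτ => ?_
        by_contra hne
        refine hτ (Finset.mem_filter.2 ⟨Finset.mem_univ _, le_shadePartition_iff.2 fun V hV => ?_⟩)
        exact exists_shade_of_shadeWeight_ne_zero (Finset.prod_ne_zero_iff.1 hne V hV)

/-- A constant shading imposes no restriction, so the bracket sums the Möbius function over the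
whole interval from `π` to the one-block partition. -/
theorem momentPoly_const (hn : 0 < n) (δ : Shade) :
    momentPoly α (Function.const _ δ) =
      MvPolynomial.X (δ, ⟨Finset.univ, ⟨⟨0, hn⟩, Finset.mem_univ _⟩⟩) := by
  classical
  have hle : ∀ π : NodePartition n, π ≤ shadePartition (Function.const _ δ) := fun π =>
    le_shadePartition_iff.2 fun _ _ => ⟨δ, fun _ _ => rfl⟩
  have hne : (Finset.univ : Finset (Fin n)) ≠ ⊥ :=
    Finset.nonempty_iff_ne_empty.1 ⟨⟨0, hn⟩, Finset.mem_univ _⟩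
  let top : BNC α := ⟨Finpartition.indiscrete hne, by
    rw [isBiNonCrossing_iff]
    constructor
    · simpa using Finset.nonempty_iff_ne_empty.2 hne
    · simp
    · simp
    · simp⟩
  have htop : ∀ π : BNC α, π ≤ top := fun π V _ =>
    ⟨Finset.univ, Finset.mem_singleton_self _, Finset.subset_univ V⟩
  have hmu : ∀ π : BNC α,
      ∑ σ : BNC α with π ≤ σ ∧ σ.1 ≤ shadePartition (Function.const _ δ), muBNC α π σ =
        if π = top then 1 else 0 := by
    intro π
    rw [← IncidenceAlgebra.sum_Icc_mu_right (𝕜 := ℂ) π top]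
    refine Finset.sum_congr (Finset.ext fun σ => ?_) fun σ _ => ?_
    · simp [hle, htop]
    · unfold muBNC
      congr!
  rw [momentPoly, Finset.sum_eq_single top]
  · have := hmu top
    rw [if_pos rfl] at this
    have hattach : top.1.parts.attach = {⟨Finset.univ, Finset.mem_singleton_self _⟩} := by
      ext V
      simp only [Finset.mem_attach, Finset.mem_singleton, true_iff]
      exact Subtype.ext (Finset.mem_singleton.1 V.2)
    rw [hattach, Finset.prod_singleton]
    rw [show (∑ σ : BNC α with top ≤ σ ∧ σ.1 ≤ shadePartition (Function.const _ δ),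
      muBNC α top σ) = 1 by convert this, map_one, one_mul]
    rfl
  · intro π _ hπ
    have := hmu π
    rw [if_neg hπ] at this
    rw [show (∑ σ : BNC α with π ≤ σ ∧ σ.1 ≤ shadePartition (Function.const _ δ),
      muBNC α π σ) = 0 by convert this, map_zero, zero_mul]
  · intro h
    exact (h (Finset.mem_filter.2 ⟨Finset.mem_univ _, hle _⟩)).elim

theorem sumPoly_eq (hn : 0 < n) :
    sumPoly α =
      MvPolynomial.X (.prime, ⟨Finset.univ, ⟨⟨0, hn⟩, Finset.mem_univ _⟩⟩) +
      MvPolynomial.X (.dprime, ⟨Finset.univ, ⟨⟨0, hn⟩, Finset.mem_univ _⟩⟩) +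
      ∑ ε : Fin n → Shade with ∀ δ, ε ≠ Function.const _ δ, momentPoly α ε := by
  rw [sumPoly, ← Finset.sum_filter_not_add_sum_filter _ fun ε => ∀ δ, ε ≠ Function.const _ δ,
    ← momentPoly_const α hn, ← momentPoly_const α hn]
  congr 1
  have hne : Function.const (Fin n) Shade.prime ≠ Function.const (Fin n) Shade.dprime := fun h =>
    Shade.noConfusion (congrFun h ⟨0, hn⟩)
  rw [← Finset.sum_pair hne]
  refine Finset.sum_congr (Finset.ext fun ε => ?_) fun _ _ => rfl
  simp only [Finset.mem_filter, Finset.mem_univ, true_and, Finset.mem_insert,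
    Finset.mem_singleton, not_forall, not_not]
  constructor
  · rintro ⟨δ | δ, h⟩
    exacts [Or.inl h, Or.inr h]
  · rintro (h | h)
    exacts [⟨_, h⟩, ⟨_, h⟩]

/-! ### From bi-free families to the free product -/

open FreeProd in
theorem BiFree.exists_model {A : Type w} [Ring A] [Algebra ℂ A] {φ : A →ₗ[ℂ] ℂ}
    {z : Shade → I ⊕ J → A} (h : BiFree.{u, v, w, x} φ z) :
    ∃ (X : Shade → StateVectorSpace.{x}) (T : Fin n → (δ : Shade) → Module.End ℂ (X δ)),
      ∀ (ε : Fin n → Shade) (K : Finset (Fin n)),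
        φ ((K.sort (· ≤ ·)).map fun k => z (ε k) (α k)).prod =
          wordMoment (fun k => (α k).isLeft = true) T ε K := by
  obtain ⟨X, l, r, h⟩ := h
  refine ⟨X, fun k δ => Sum.elim (fun i => l δ (FreeAlgebra.ι ℂ i))
    (fun j => r δ (FreeAlgebra.ι ℂ j)) (α k), fun ε K => ?_⟩
  have h' := LinearMap.congr_fun h
    (((K.sort (· ≤ ·)).map fun k => FreeAlgebra.ι ℂ (ε k, α k)).prod)
  simp only [jointDistribution, LinearMap.comp_apply, AlgHom.toLinearMap_apply, map_list_prod,
    List.map_map, Function.comp_def, FreeAlgebra.lift_ι_apply] at h'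
  rw [← h']
  unfold wordMoment wordVec
  simp only [StateVectorSpace.vacuumState, LinearMap.comp_apply, LinearMap.applyₗ_apply_apply]
  change TensorAlgebra.algebraMapInv (Subtype.val _) = _
  congr 1
  induction K.sort (· ≤ ·) with
  | nil => rfl
  | cons t L ih =>
    simp only [List.map_cons, List.prod_cons, Module.End.mul_apply]
    rw [← ih, nodeAct]
    rcases α t with i | j
    · rfl
    · rfl

theorem orderedMoment_eq_eval {A : Type w} [Ring A] [Algebra ℂ A] {φ : A →ₗ[ℂ] ℂ}
    {z : Shade → I ⊕ J → A} (h : BiFree.{u, v, w, x} φ z) (ε : Fin n → Shade) :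
    orderedMoment φ (fun k => z (ε k) (α k)) =
      MvPolynomial.eval (momentPoint φ z α) (momentPoly α ε) := by
  obtain ⟨X, T, hT⟩ := h.exists_model α
  -- The model serves all shadings at once; the constant ones show that each family has the moments
  -- of its operators on `X δ`.
  have hpoint : momentPoint φ z α = fun p => faceMoment T p.1 p.2.1 := by
    funext p
    have := hT (fun _ => p.1) p.2.1
    rw [wordMoment, wordVec_of_const _ _ _ fun _ => rfl, algebraMapInv_embed] at this
    exact this
  have hL : ∀ t k, t ≤ k → (α t).isLeft = true → sideKey α t ≤ sideKey α k := by
    intro t k htk ht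
    have := t.2
    have := k.2
    have := Fin.le_def.1 htk
    unfold sideKey
    split_ifs <;> omega
  have hR : ∀ t k, t ≤ k → ¬ (α t).isLeft = true → sideKey α k ≤ sideKey α t := by
    intro t k htk ht
    have := t.2
    have := k.2
    have := Fin.le_def.1 htk
    unfold sideKey
    split_ifs <;> omega
  have e := hT ε Finset.univ
  rw [wordMoment_eq_ncSum _ T ε (sideKey_injective α) hL hR, Fin.sort_univ] at e
  rw [hpoint, eval_momentPoly, ← e, orderedMoment, List.ofFn_eq_map]

theorem orderedMoment_add {A : Type w} [Ring A] [Algebra ℂ A] (φ : A →ₗ[ℂ] ℂ)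
    (z : Shade → I ⊕ J → A) :
    orderedMoment φ (fun k => (z .prime + z .dprime) (α k)) =
      ∑ ε : Fin n → Shade, orderedMoment φ (fun k => z (ε k) (α k)) := by
  have h := (MultilinearMap.mkPiAlgebraFin ℂ n A).map_sum fun k (δ : Shade) => z δ (α k)
  simp only [MultilinearMap.mkPiAlgebraFin_apply] at h
  have h2 : ∀ k, (z .prime + z .dprime) (α k) = ∑ δ, z δ (α k) := fun k => by
    rw [show (Finset.univ : Finset Shade) = {.prime, .dprime} from rfl,
      Finset.sum_pair (by simp)]
    rfl
  simp only [orderedMoment, h2, h, map_sum]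

end MomentFormula

theorem mainTheorem7 {I : Type u} {J : Type v} {n : ℕ} (hn : 0 < n)
    (α : Fin n → I ⊕ J) :
    (∀ (A : Type w) [Ring A] [Algebra ℂ A] (φ : A →ₗ[ℂ] ℂ), φ 1 = 1 →
      ∀ z : Shade → I ⊕ J → A, BiFree.{u, v, w, x} φ z →
        (∀ ε : Fin n → Shade,
          orderedMoment φ (fun k => z (ε k) (α k)) =
            MvPolynomial.eval (momentPoint φ z α) (momentPoly α ε)) ∧
        orderedMoment φ (fun k => (z .prime + z .dprime) (α k)) =
          MvPolynomial.eval (momentPoint φ z α) (sumPoly α)) ∧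
    sumPoly α =
      MvPolynomial.X (.prime, ⟨Finset.univ, ⟨⟨0, hn⟩, Finset.mem_univ _⟩⟩) +
      MvPolynomial.X (.dprime, ⟨Finset.univ, ⟨⟨0, hn⟩, Finset.mem_univ _⟩⟩) +
      ∑ ε : Fin n → Shade with ∀ δ, ε ≠ Function.const _ δ, momentPoly α ε := by
  refine ⟨fun A _ _ φ _ z hz => ⟨orderedMoment_eq_eval α hz, ?_⟩, sumPoly_eq α hn⟩
  rw [orderedMoment_add, sumPoly, map_sum]
  exact Finset.sum_congr rfl fun ε _ => orderedMoment_eq_eval α hz ε
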